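/- Let $k\in\mathbb N=\{0,1,2,\dots\}$ and let $\Lambda$ be a $k$-graph: a countable small category with a degree functor $d:\Lambda\to\mathbb N^k$ such that, whenever $d(\lambda)=m+n$, there are unique $\mu,\nu\in\Lambda$ with $d(\mu)=m$, $d(\nu)=n$ and $\lambda=\mu\nu$. Write $r,s$ for range and source, $\Lambda^0$ for the set of objects (identified with the paths of degree $0$), and $v\Lambda=\{\lambda: r(\lambda)=v\}$. Put $\Lambda^{\min}(\lambda,\mu)=\{(\alpha,\beta)\in\Lambda\times\Lambda:\lambda\alpha=\mu\beta,\ d(\lambda\alpha)=d(\lambda)\vee d(\mu)\}$, and assume that $\Lambda$ is finitely aligned, i.e. every $\Lambda^{\min}(\lambda,\mu)$ is finite. A finite set $E\subseteq v\Lambda$ is exhaustive if for each $\mu\in v\Lambda$ there is $\lambda\in E$ with $\Lambda^{\min}(\lambda,\mu)\neq\emptyset$. For $m\in(\mathbb N\cup\{\infty\})^k$ let $\Omega_{k,m}$ be the category with objects $\{p\in\mathbb N^k:p\le m\}$ and one morphism $(p,q)$, of degree $q-p$, range $p$ and source $q$, for each $p\le q\le m$. The boundary-path space $\partial\Lambda$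 is the set of all degree-preserving functors $x:\Omega_{k,m}\to\Lambda$, with $m=:d(x)$ arbitrary, such that for all $n\in\mathbb N^k$ with $n\le d(x)$ and all finite exhaustive $E\subseteq x(n)\Lambda$ there is $\lambda\in E$ with $n+d(\lambda)\le d(x)$ and $x(n,n+d(\lambda))=\lambda$. Give $\partial\Lambda$ the topology generated by the sets $D_\lambda\setminus\bigcup_{\nu\in F}D_{\lambda\nu}$, where $\lambda\in\Lambda$, $F\subseteq s(\lambda)\Lambda$ is finite, and $D_\lambda=\{x\in\partial\Lambda: d(x)\ge d(\lambda),\ x(0,d(\lambda))=\lambda\}$. For $n\in\mathbb N^k$ let $\partial\Lambda^{\ge n}=\{x\in\partial\Lambda:d(x)\ge n\}$ with the subspace topology, and let $\sigma_n:\partial\Lambda^{\ge n}\to\partial\Lambda$ be the shift, $\sigma_n(x)(p,q)=x(p+n,q+n)$, with $d(\sigma_n(x))=d(x)-n$. Let $X_n$ be the Hilbert $C_0(\partial\Lambda)$-module obtained by completing $C_c(\partial\Lambda^{\ge n})$ with respect to $$(f\cdot a)(x)=f(x)\,a(\sigma_n(x)),\qquad \langle f,g\rangle_n(x)=\sum_{\sigma_n(y)=x}\overline{f(y)}\,g(y),\qquad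 \|f\|_n=\|\langle f,f\rangle_n\|_\infty^{1/2}$$ (so $X_n=0$ if $\partial\Lambda^{\ge n}=\emptyset$), and let $X_l\times X_m\to X_{l+m}$, $(x,y)\mapsto xy$, be the continuous extension of the multiplication $(fg)(x)=f(x)\,g(\sigma_l(x))$ of $f\in C_c(\partial\Lambda^{\ge l})$ and $g\in C_c(\partial\Lambda^{\ge m})$. The family $X=(X_n)_{n\in\mathbb N^k}$ with this multiplication is the boundary-path product system of $\Lambda$; the left action of $C_0(\partial\Lambda)=X_0$ is multiplication by elements of $X_0$. Write $\mathcal L(X_n)$ for the adjointable operators on $X_n$, and $\mathcal K(X_n)$ for the closed linear span, in the operator norm, of the operators $\Theta_{x,y}:z\mapsto x\cdot\langle y,z\rangle_n$ with $x,y\in X_n$. **Proposition 6.1.** The product system $X$ is compactly aligned. That is, for all $m,n\in\mathbb N^k$, $S\in\mathcal K(X_m)$ and $T\in\mathcal K(X_n)$, there are unique operators $\iota_m^{m\vee n}(S),\ \iota_n^{m\vee n}(T)\in\mathcal L(X_{m\vee n})$ such that $$\iota_m^{m\vee n}(S)(xy)=(Sx)y\quad\text{for all }x\in X_m,\ y\in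 X_{m\vee n-m},$$ $$\iota_n^{m\vee n}(T)(xy)=(Tx)y\quad\text{for all }x\in X_n,\ y\in X_{m\vee n-n},$$ and $\iota_m^{m\vee n}(S)\,\iota_n^{m\vee n}(T)\in\mathcal K(X_{m\vee n})$. -/

import Mathlib

open Set Filter Topology
open CategoryTheory (Category)
open scoped CategoryTheory
open scoped ZeroAtInfty CompactlySupported ComplexConjugate

universe u

/-- A `k`-graph: a countable (small) category together with a degree functor to the monoid `ℕᵏ`
satisfying the unique factorisation property. A morphism `λ : v ⟶ w` of the category has source
`v` and range `w`, and the product `λμ` of the `k`-graph literature is the composite of `λ` after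
`μ`, that is, `μ ≫ λ` in Mathlib's notation. -/
structure KGraph (k : ℕ) where
  Vertex : Type u
  [cat : CategoryTheory.SmallCategory Vertex]
  countable_hom : Countable (Σ v w : Vertex, v ⟶ w)
  degHom : ∀ {v w : Vertex}, (v ⟶ w) → (Fin k → ℕ)
  degHom_id : ∀ v : Vertex, degHom (𝟙 v) = 0
  degHom_comp : ∀ {u v w : Vertex} (f : u ⟶ v) (g : v ⟶ w),
    degHom (f ≫ g) = degHom g + degHom f
  factorisation : ∀ {u w : Vertex} (f : u ⟶ w) (m n : Fin k → ℕ), degHom f = m + n →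
    ∃! p : Σ v : Vertex, (v ⟶ w) × (u ⟶ v),
      degHom p.2.1 = m ∧ degHom p.2.2 = n ∧
        p.2.2 ≫ p.2.1 = f

namespace KGraph

attribute [instance] KGraph.cat

variable {k : ℕ}

/-- The paths of a `k`-graph: the morphisms of the category, of arbitrary source and range. -/
structure Path (Λ : KGraph k) where
  source : Λ.Vertex
  range : Λ.Vertex
  hom : source ⟶ range

section Paths

variable {Λ : KGraph k}

/-- The source of a path. -/
def s (l : Λ.Path) : Λ.Vertex := l.source

/-- The range of a path. -/
def r (l : Λ.Path) : Λ.Vertex := l.range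

/-- The degree of a path. -/
def d (l : Λ.Path) : Fin k → ℕ := Λ.degHom l.hom

/-- The vertex `v` as a path of degree zero. -/
def idPath (v : Λ.Vertex) : Λ.Path := ⟨v, v, 𝟙 v⟩

open Classical in
/-- The product `λμ` of two paths with `s(λ) = r(μ)`. (For other pairs the value is a
placeholder; every use below is guarded by the condition `s λ = r μ`.) -/
noncomputable def mul (l m : Λ.Path) : Λ.Path :=
  if h : r m = s l then
    ⟨s m, r l, m.hom ≫ CategoryTheory.eqToHom h ≫ l.hom⟩
  else l

lemma mul_mk {u v w : Λ.Vertex} (f : u ⟶ v) (g : v ⟶ w) :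
    mul (Λ := Λ) ⟨v, w, g⟩ ⟨u, v, f⟩ = ⟨u, w, f ≫ g⟩ := by
  have h : f ≫ CategoryTheory.eqToHom (rfl : v = v) ≫ g = f ≫ g := by simp
  have h' : r (Λ := Λ) ⟨u, v, f⟩ = s (Λ := Λ) ⟨v, w, g⟩ := rfl
  rw [mul, dif_pos h']
  exact congrArg (Path.mk u w) h

lemma s_mul {l m : Λ.Path} (h : s l = r m) : s (mul l m) = s m := by
  obtain ⟨v, w, g⟩ := l
  obtain ⟨u, v', f⟩ := m
  obtain rfl : v = v' := h
  rw [mul_mk]; rfl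

lemma r_mul {l m : Λ.Path} (h : s l = r m) : r (mul l m) = r l := by
  obtain ⟨v, w, g⟩ := l
  obtain ⟨u, v', f⟩ := m
  obtain rfl : v = v' := h
  rw [mul_mk]; rfl

lemma d_mul {l m : Λ.Path} (h : s l = r m) : d (mul l m) = d l + d m := by
  obtain ⟨v, w, g⟩ := l
  obtain ⟨u, v', f⟩ := m
  obtain rfl : v = v' := h
  rw [mul_mk]; exact Λ.degHom_comp f g

lemma mul_assoc' {a b c : Λ.Path} (h : s a = r b) (h' : s b = r c) :
    mul (mul a b) c = mul a (mul b c) := by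
  obtain ⟨v, w, g⟩ := a
  obtain ⟨u, v', f⟩ := b
  obtain ⟨t, u', e⟩ := c
  obtain rfl : v = v' := h
  obtain rfl : u = u' := h'
  simp [mul_mk]

@[simp] lemma s_id (v : Λ.Vertex) : s (idPath v) = v := rfl
@[simp] lemma r_id (v : Λ.Vertex) : r (idPath v) = v := rfl
@[simp] lemma d_id (v : Λ.Vertex) : d (idPath v) = 0 := Λ.degHom_id v

lemma mul_id (l : Λ.Path) : mul l (idPath (s l)) = l := by
  obtain ⟨v, w, g⟩ := l
  exact (mul_mk _ _).trans (congrArg (Path.mk v w) (Category.id_comp g))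

lemma id_mul (l : Λ.Path) : mul (idPath (r l)) l = l := by
  obtain ⟨v, w, g⟩ := l
  exact (mul_mk _ _).trans (congrArg (Path.mk v w) (Category.comp_id g))

lemma exists_fact (t : Λ.Path) (m n : Fin k → ℕ) (h : d t = m + n) :
    ∃ a b : Λ.Path, s a = r b ∧ d a = m ∧ d b = n ∧ mul a b = t := by
  obtain ⟨u, w, f⟩ := t
  obtain ⟨⟨v, g, e⟩, ⟨h1, h2, h3⟩, -⟩ := Λ.factorisation f m n h
  exact ⟨⟨v, w, g⟩, ⟨u, v, e⟩, rfl, h1, h2, by rw [mul_mk]; dsimp at h3; rw [h3]⟩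

lemma fact_unique {a b a' b' : Λ.Path} (h : s a = r b) (h' : s a' = r b')
    (hm : mul a b = mul a' b') (hd : d a = d a') : a = a' ∧ b = b' := by
  have hdd := congrArg d hm
  rw [d_mul h, d_mul h', hd, add_right_inj] at hdd
  obtain ⟨v, w, g⟩ := a
  obtain ⟨u, v1, e⟩ := b
  obtain rfl : v = v1 := h
  obtain ⟨v', w', g'⟩ := a'
  obtain ⟨u', v1, e'⟩ := b'
  obtain rfl : v' = v1 := h'
  rw [mul_mk, mul_mk] at hm
  obtain rfl : u = u' := congrArg Path.source hm
  obtain rfl : w = w' := congrArg Path.range hm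
  have hm' : e ≫ g = e' ≫ g' := by
    simpa using hm
  have key := (Λ.factorisation (e ≫ g) (Λ.degHom g) (Λ.degHom e)
    (Λ.degHom_comp _ _)).unique (y₁ := ⟨v, g, e⟩) (y₂ := ⟨v', g', e'⟩)
    ⟨rfl, rfl, rfl⟩ ⟨hd.symm, hdd.symm, hm'.symm⟩
  cases key
  exact ⟨rfl, rfl⟩

lemma eq_id_of_d_eq_zero {a : Λ.Path} (h : d a = 0) : a = idPath (r a) := by
  have := fact_unique (a := a) (b := idPath (s a)) (a' := idPath (r a)) (b' := a) rfl rfl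
    ((mul_id a).trans (id_mul a).symm) (by simp [h])
  exact this.1

/-- The set `Λ^min(λ, μ)` of minimal common extensions. -/
def minExt (l m : Λ.Path) : Set (Λ.Path × Λ.Path) :=
  {p | s l = r p.1 ∧ s m = r p.2 ∧ mul l p.1 = mul m p.2 ∧ d (mul l p.1) = d l ⊔ d m}

/-- `E` is a finite exhaustive subset of `vΛ`. -/
def IsFiniteExhaustive (v : Λ.Vertex) (E : Finset Λ.Path) : Prop :=
  (∀ l ∈ E, r l = v) ∧ ∀ m : Λ.Path, r m = v → ∃ l ∈ E, (minExt l m).Nonempty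

/-- Two paths with a common extension have a minimal common extension through which it factors. -/
lemma exists_minExt {l m a b : Λ.Path} (ha : s l = r a) (hb : s m = r b)
    (h : mul l a = mul m b) : ∃ a' b' c, (a', b') ∈ minExt l m ∧ s a' = r c ∧ s b' = r c ∧
      mul a' c = a ∧ mul b' c = b := by
  have hd : d l + d a = d m + d b := by rw [← d_mul ha, ← d_mul hb, h]
  have hla : d a = (d l ⊔ d m - d l) + (d l + d a - d l ⊔ d m) := by
    ext i
    have := congrFun hd i
    simp only [Pi.add_apply, Pi.sub_apply, Pi.sup_apply] at *
    omega
  have hmb : d b = (d l ⊔ d m - d m) + (d l + d a - d l ⊔ d m) := by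
    ext i
    have := congrFun hd i
    simp only [Pi.add_apply, Pi.sub_apply, Pi.sup_apply] at *
    omega
  obtain ⟨a', c, h1, h2, h3, rfl⟩ := exists_fact a _ _ hla
  obtain ⟨b', c', h4, h5, h6, rfl⟩ := exists_fact b _ _ hmb
  rw [r_mul h1] at ha
  rw [r_mul h4] at hb
  have e : d (mul l a') = d l ⊔ d m := by
    rw [d_mul ha, h2]; ext i; simp only [Pi.add_apply, Pi.sub_apply, Pi.sup_apply]; omega
  have e' : d (mul m b') = d l ⊔ d m := by
    rw [d_mul hb, h5]; ext i; simp only [Pi.add_apply, Pi.sub_apply, Pi.sup_apply]; omega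
  rw [← mul_assoc' ha h1, ← mul_assoc' hb h4] at h
  obtain ⟨h7, rfl⟩ := fact_unique (by rw [s_mul ha, h1]) (by rw [s_mul hb, h4]) h (e.trans e'.symm)
  exact ⟨a', b', c, ⟨ha, hb, h7, e⟩, h1, h4, rfl, rfl⟩

end Paths

/-- A `k`-graph is finitely aligned if all the sets `Λ^min(λ, μ)` are finite. -/
class FinitelyAligned (Λ : KGraph k) : Prop where
  finite_minExt : ∀ l m : Λ.Path, (minExt l m).Finite

/-- An element of `ℕᵏ` viewed in `(ℕ ∪ {∞})ᵏ`. -/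
def up (n : Fin k → ℕ) : Fin k → ℕ∞ := fun i => (n i : ℕ∞)

/-- A graph morphism `x : Ω_{k,m} → Λ`, i.e. a degree-preserving functor, `m ∈ (ℕ ∪ {∞})ᵏ`. It is
given by its degree `m` and by the images `x(p, q)` of the morphisms `(p, q)`, `p ≤ q ≤ m`, of
`Ω_{k,m}`; the image of an object `p` is determined by the path `x(p, p)` of degree zero. -/
structure GraphMorphism (Λ : KGraph k) where
  deg : Fin k → ℕ∞
  seg : ∀ p q : Fin k → ℕ, p ≤ q → up q ≤ deg → Λ.Path
  d_seg : ∀ p q h h', d (seg p q h h') = q - p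
  s_seg : ∀ p q t (h : p ≤ q) (h' : q ≤ t) (hq : up q ≤ deg) (ht : up t ≤ deg),
    s (seg p q h hq) = r (seg q t h' ht)
  mul_seg : ∀ p q t (h : p ≤ q) (h' : q ≤ t) (hq : up q ≤ deg) (ht : up t ≤ deg),
    mul (seg p q h hq) (seg q t h' ht) = seg p t (h.trans h') ht

section Prefix

variable {Λ : KGraph k}

/-- `a` is an initial segment of `t`. -/
def IsPrefix (a t : Λ.Path) : Prop := ∃ b, s a = r b ∧ mul a b = t

lemma IsPrefix.trans {a b c : Λ.Path} (h : IsPrefix a b) (h' : IsPrefix b c) : IsPrefix a c := by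
  obtain ⟨x, hx, rfl⟩ := h
  obtain ⟨y, hy, rfl⟩ := h'
  rw [s_mul hx] at hy
  exact ⟨mul x y, by rw [r_mul hy, hx], (mul_assoc' hx hy).symm⟩

lemma IsPrefix.d_le {a t : Λ.Path} (h : IsPrefix a t) : d a ≤ d t := by
  obtain ⟨x, hx, rfl⟩ := h
  rw [d_mul hx]; exact le_self_add

lemma IsPrefix.r_eq {a t : Λ.Path} (h : IsPrefix a t) : r a = r t := by
  obtain ⟨x, hx, rfl⟩ := h
  rw [r_mul hx]

/-- The path `b` with `t = ab`, for an initial segment `a` of `t`. -/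
noncomputable def IsPrefix.rest {a t : Λ.Path} (h : IsPrefix a t) : Λ.Path := h.choose

lemma IsPrefix.s_eq {a t : Λ.Path} (h : IsPrefix a t) : s a = r h.rest := h.choose_spec.1

lemma IsPrefix.mul_rest {a t : Λ.Path} (h : IsPrefix a t) : mul a h.rest = t := h.choose_spec.2

lemma IsPrefix.s_rest {a t : Λ.Path} (h : IsPrefix a t) : s h.rest = s t := by
  rw [← s_mul h.s_eq, h.mul_rest]

lemma isPrefix_refl (a : Λ.Path) : IsPrefix a a := ⟨idPath (s a), rfl, mul_id a⟩

lemma exists_isPrefix {t : Λ.Path} {q : Fin k → ℕ} (h : q ≤ d t) :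
    ∃ a, IsPrefix a t ∧ d a = q := by
  obtain ⟨a, b, h1, h2, -, h4⟩ := exists_fact t q (d t - q) (add_tsub_cancel_of_le h).symm
  exact ⟨a, ⟨b, h1, h4⟩, h2⟩

lemma IsPrefix.eq {a c t : Λ.Path} (h : IsPrefix a t) (h' : IsPrefix c t) (hd : d a = d c) :
    a = c := by
  obtain ⟨x, hx, rfl⟩ := h
  obtain ⟨y, hy, h⟩ := h'
  exact (fact_unique hx hy h.symm hd).1

lemma IsPrefix.of_le {a c t : Λ.Path} (h : IsPrefix a t) (h' : IsPrefix c t) (hd : d a ≤ d c) :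
    IsPrefix a c := by
  obtain ⟨a', h1, h2⟩ := exists_isPrefix hd
  rwa [← (h1.trans h').eq h h2]

lemma IsPrefix.mul_left {a t l : Λ.Path} (h : IsPrefix a t) (hl : s l = r a) :
    IsPrefix (mul l a) (mul l t) := by
  obtain ⟨x, hx, rfl⟩ := h
  exact ⟨x, by rw [s_mul hl, hx], mul_assoc' hl hx⟩

lemma isPrefix_mul {a b : Λ.Path} (h : s a = r b) : IsPrefix a (mul a b) := ⟨b, h, rfl⟩

lemma IsPrefix.of_mul_left {a t l : Λ.Path} (hl : s l = r a) (ht : s l = r t)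
    (h : IsPrefix (mul l a) (mul l t)) : IsPrefix a t := by
  obtain ⟨x, hx, h⟩ := h
  rw [s_mul hl] at hx
  rw [mul_assoc' hl hx] at h
  exact ⟨x, hx, (fact_unique (by rw [r_mul hx, hl]) ht h rfl).2⟩

end Prefix

lemma up_le_up {p q : Fin k → ℕ} : up p ≤ up q ↔ p ≤ q := by
  simp [up, Pi.le_def]

lemma up_add (p q : Fin k → ℕ) : up (p + q) = up p + up q := by
  ext i; simp [up]

lemma up_sup (p q : Fin k → ℕ) : up (p ⊔ q) = up p ⊔ up q := by
  ext i; exact Monotone.map_sup (fun _ _ h => Nat.cast_le.2 h) _ _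

lemma up_zero_le (m : Fin k → ℕ∞) : up 0 ≤ m := fun i => by simp [up]

lemma up_add_le_of_le_sub {n q : Fin k → ℕ} {m : Fin k → ℕ∞} (hn : up n ≤ m)
    (hq : up q ≤ m - up n) : up (n + q) ≤ m := by
  rw [up_add]
  intro i
  exact add_le_of_le_tsub_left_of_le (hn i) (hq i)

lemma up_le_sub {n q : Fin k → ℕ} {m : Fin k → ℕ∞} (hq : up (n + q) ≤ m) :
    up q ≤ m - up n := by
  rw [up_add] at hq
  intro i
  exact ENat.le_sub_of_add_le_left (ENat.natCast_ne_top _) (hq i)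

lemma up_sub_le {n q : Fin k → ℕ} {m : Fin k → ℕ∞} (hq : up q ≤ up n + m) :
    up (q - n) ≤ m := by
  intro i
  have := hq i
  simp only [up, Pi.add_apply, Pi.sub_apply] at *
  rw [ENat.natCast_sub]
  exact tsub_le_iff_left.2 this

namespace GraphMorphism

variable {Λ : KGraph k}

lemma ext_seg {x y : Λ.GraphMorphism} (hd : x.deg = y.deg)
    (h : ∀ p q hpq hx hy, x.seg p q hpq hx = y.seg p q hpq hy) : x = y := by
  cases x; cases y
  obtain rfl : _ = _ := hd
  congr
  ext1 p; ext1 q; ext1 hpq; ext1 hx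
  exact h p q hpq hx hx

/-- The initial segment `x(0, q)`. -/
def init (x : Λ.GraphMorphism) (q : Fin k → ℕ) (h : up q ≤ x.deg) : Λ.Path :=
  x.seg 0 q (zero_le) h

/-- The vertex `x(p)`. -/
def vertex (x : Λ.GraphMorphism) (p : Fin k → ℕ) (h : up p ≤ x.deg) : Λ.Vertex :=
  r (x.seg p p le_rfl h)

lemma seg_congr (x : Λ.GraphMorphism) {p p' q q' : Fin k → ℕ} (hp : p = p') (hq : q = q')
    (h : p ≤ q) (h' : up q ≤ x.deg) :
    x.seg p q h h' = x.seg p' q' (hp ▸ hq ▸ h) (hq ▸ h') := by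
  subst hp hq; rfl

lemma r_seg (x : Λ.GraphMorphism) {p q : Fin k → ℕ} (h : p ≤ q) (h' : up q ≤ x.deg) :
    r (x.seg p q h h') = x.vertex p ((up_le_up.2 h).trans h') := by
  rw [← x.mul_seg p p q le_rfl h ((up_le_up.2 h).trans h') h',
    r_mul (x.s_seg p p q le_rfl h ((up_le_up.2 h).trans h') h')]
  rfl

lemma s_seg' (x : Λ.GraphMorphism) {p q : Fin k → ℕ} (h : p ≤ q) (h' : up q ≤ x.deg) :
    s (x.seg p q h h') = x.vertex q h' := x.s_seg p q q h le_rfl h' h'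

lemma d_init (x : Λ.GraphMorphism) {q : Fin k → ℕ} (h : up q ≤ x.deg) : d (x.init q h) = q := by
  rw [init, x.d_seg, tsub_zero]

lemma s_init (x : Λ.GraphMorphism) {q : Fin k → ℕ} (h : up q ≤ x.deg) :
    s (x.init q h) = x.vertex q h := x.s_seg' _ h

lemma r_init (x : Λ.GraphMorphism) {q : Fin k → ℕ} (h : up q ≤ x.deg) :
    r (x.init q h) = x.vertex 0 (up_zero_le _) := x.r_seg _ h

lemma init_mul_seg (x : Λ.GraphMorphism) {p q : Fin k → ℕ} (h : p ≤ q) (h' : up q ≤ x.deg) :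
    mul (x.init p ((up_le_up.2 h).trans h')) (x.seg p q h h') = x.init q h' :=
  x.mul_seg 0 p q _ h _ h'

lemma s_init_eq (x : Λ.GraphMorphism) {p q : Fin k → ℕ} (h : p ≤ q) (h' : up q ≤ x.deg) :
    s (x.init p ((up_le_up.2 h).trans h')) = r (x.seg p q h h') := by
  rw [s_init, r_seg]

lemma isPrefix_init (x : Λ.GraphMorphism) {p q : Fin k → ℕ} (h : p ≤ q) (h' : up q ≤ x.deg) :
    IsPrefix (x.init p ((up_le_up.2 h).trans h')) (x.init q h') :=
  ⟨_, x.s_init_eq h h', x.init_mul_seg h h'⟩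

lemma seg_eq_of_mul (x : Λ.GraphMorphism) {p q : Fin k → ℕ} (h : p ≤ q) (h' : up q ≤ x.deg)
    {b : Λ.Path} (hb : s (x.init p ((up_le_up.2 h).trans h')) = r b)
    (hm : mul (x.init p ((up_le_up.2 h).trans h')) b = x.init q h') : x.seg p q h h' = b :=
  (fact_unique (x.s_init_eq h h') hb ((x.init_mul_seg h h').trans hm.symm) rfl).2

lemma ext_init {x y : Λ.GraphMorphism} (hd : x.deg = y.deg)
    (h : ∀ q hx hy, x.init q hx = y.init q hy) : x = y := by
  refine ext_seg hd fun p q hpq hx hy => ?_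
  refine x.seg_eq_of_mul hpq hx ?_ ?_
  · rw [h p _ ((up_le_up.2 hpq).trans hy), y.s_init_eq hpq hy]
  · rw [h p _ ((up_le_up.2 hpq).trans hy), y.init_mul_seg hpq hy, h q hx hy]

/-- The graph morphism with a given coherent family of initial segments. -/
noncomputable def ofInit (m : Fin k → ℕ∞) (f : ∀ q, up q ≤ m → Λ.Path) (hf : ∀ q h, d (f q h) = q)
    (hc : ∀ p q hp hq, p ≤ q → IsPrefix (f p hp) (f q hq)) : Λ.GraphMorphism where
  deg := m
  seg p q h h' := (hc p q ((up_le_up.2 h).trans h') h' h).rest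
  d_seg p q h h' := by
    have := hc p q ((up_le_up.2 h).trans h') h' h
    have e := congrArg d this.mul_rest
    rw [d_mul this.s_eq, hf, hf] at e
    exact eq_tsub_of_add_eq ((add_comm _ _).trans e)
  s_seg p q t h h' hq ht := by
    rw [IsPrefix.s_rest, ← IsPrefix.s_eq]
  mul_seg p q t h h' hq ht := by
    have h1 := hc p q ((up_le_up.2 h).trans hq) hq h
    have h2 := hc q t ((up_le_up.2 h').trans ht) ht h'
    have h3 := hc p t ((up_le_up.2 (h.trans h')).trans ht) ht (h.trans h')
    have h4 : s h1.rest = r h2.rest := by rw [h1.s_rest, h2.s_eq]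
    refine (fact_unique (a := f p ((up_le_up.2 h).trans hq)) ?_ h3.s_eq ?_ rfl).2
    · rw [r_mul h4]; exact h1.s_eq
    · rw [← mul_assoc' h1.s_eq h4, h1.mul_rest, h2.mul_rest, h3.mul_rest]

lemma ofInit_init {m : Fin k → ℕ∞} {f : ∀ q, up q ≤ m → Λ.Path} {hf : ∀ q h, d (f q h) = q}
    {hc : ∀ p q hp hq, p ≤ q → IsPrefix (f p hp) (f q hq)} (q : Fin k → ℕ) (h : up q ≤ m) :
    (ofInit m f hf hc).init q h = f q h := by
  have h1 := hc 0 q (up_zero_le _) h zero_le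
  have h2 := eq_id_of_d_eq_zero (hf 0 (up_zero_le _))
  have h3 : s (f 0 (up_zero_le m)) = r (f 0 (up_zero_le m)) := by rw [h2]; rfl
  have e : (ofInit m f hf hc).init q h = h1.rest := rfl
  have h4 := h1.s_eq
  have h5 := h1.mul_rest
  rw [e]
  generalize h1.rest = b at h4 h5
  rw [h2, ← h3, h4, id_mul] at h5
  exact h5

/-- The shift `σ_n(x)`, for `d(x) ≥ n`: it has degree `d(x) - n` and
`σ_n(x)(p, q) = x(p + n, q + n)`. -/
def shift (n : Fin k → ℕ) (x : Λ.GraphMorphism) (hn : up n ≤ x.deg) : Λ.GraphMorphism where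
  deg := x.deg - up n
  seg p q h h' := x.seg (n + p) (n + q) (add_le_add_right h n) (up_add_le_of_le_sub hn h')
  d_seg p q h h' := by rw [x.d_seg]; exact add_tsub_add_eq_tsub_left _ _ _
  s_seg p q t h h' hq ht := x.s_seg _ _ _ _ _ _ _
  mul_seg p q t h h' hq ht := x.mul_seg _ _ _ _ _ _ _

lemma init_shift {n : Fin k → ℕ} {x : Λ.GraphMorphism} (hn : up n ≤ x.deg) {q : Fin k → ℕ}
    (hq : up q ≤ x.deg - up n) :
    s (x.init n hn) = r ((x.shift n hn).init q hq) ∧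
      mul (x.init n hn) ((x.shift n hn).init q hq) =
      x.init (n + q) (up_add_le_of_le_sub hn hq) := by
  have e : (x.shift n hn).init q hq =
      x.seg n (n + q) le_self_add (up_add_le_of_le_sub hn hq) :=
    x.seg_congr (add_zero n) rfl _ _
  rw [e]
  exact ⟨x.s_init_eq _ _, x.init_mul_seg _ _⟩

end GraphMorphism

open GraphMorphism

section Prepend

variable {Λ : KGraph k}

lemma prepend_aux (l : Λ.Path) (x : Λ.GraphMorphism) (h : s l = x.vertex 0 (up_zero_le _))
    (q : Fin k → ℕ) (hq : up q ≤ up (d l) + x.deg) :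
    ∃ a, IsPrefix a (mul l (x.init (q - d l) (up_sub_le hq))) ∧ d a = q := by
  refine exists_isPrefix ?_
  rw [d_mul (by rw [h, r_init]), d_init]
  exact le_add_tsub

/-- The graph morphism `λx`, for `s(λ) = r(x)`. -/
noncomputable def prepend (l : Λ.Path) (x : Λ.GraphMorphism)
    (h : s l = x.vertex 0 (up_zero_le _)) : Λ.GraphMorphism :=
  ofInit (up (d l) + x.deg) (fun q hq => (prepend_aux l x h q hq).choose)
    (fun q hq => (prepend_aux l x h q hq).choose_spec.2) (by
      intro p q hp hq hpq
      have h1 := (prepend_aux l x h p hp).choose_spec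
      have h2 := (prepend_aux l x h q hq).choose_spec
      refine (h1.1.trans ?_).of_le h2.1 ?_
      · exact (x.isPrefix_init (tsub_le_tsub_right hpq _) (up_sub_le hq)).mul_left
          (by rw [h, r_init])
      · rw [h1.2, h2.2]; exact hpq)

lemma prepend_deg (l : Λ.Path) (x : Λ.GraphMorphism) (h : s l = x.vertex 0 (up_zero_le _)) :
    (prepend l x h).deg = up (d l) + x.deg := rfl

lemma isPrefix_prepend (l : Λ.Path) (x : Λ.GraphMorphism) (h : s l = x.vertex 0 (up_zero_le _))
    (q : Fin k → ℕ) (hq : up q ≤ up (d l) + x.deg) :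
    IsPrefix ((prepend l x h).init q hq) (mul l (x.init (q - d l) (up_sub_le hq))) := by
  have e : (prepend l x h).init q hq = (prepend_aux l x h q hq).choose := ofInit_init q hq
  rw [e]
  exact (prepend_aux l x h q hq).choose_spec.1

lemma up_add_le {n q : Fin k → ℕ} {m : Fin k → ℕ∞} (h : up q ≤ m) : up (n + q) ≤ up n + m := by
  rw [up_add]; exact add_le_add_right h _

lemma up_add_le_prepend (l : Λ.Path) (x : Λ.GraphMorphism) (h : s l = x.vertex 0 (up_zero_le _))
    {q : Fin k → ℕ} (hq : up q ≤ x.deg) : up (d l + q) ≤ (prepend l x h).deg := up_add_le hq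

lemma up_le_prepend (l : Λ.Path) (x : Λ.GraphMorphism) (h : s l = x.vertex 0 (up_zero_le _)) :
    up (d l) ≤ (prepend l x h).deg := by
  rw [prepend_deg]; exact le_self_add

lemma init_congr (x : Λ.GraphMorphism) {q q' : Fin k → ℕ} (hq : q = q') (h' : up q ≤ x.deg) :
    x.init q h' = x.init q' (hq ▸ h') := by
  subst hq; rfl

lemma prepend_init_add (l : Λ.Path) (x : Λ.GraphMorphism)
    (h : s l = x.vertex 0 (up_zero_le _)) (q : Fin k → ℕ) (hq : up q ≤ x.deg) :
    (prepend l x h).init (d l + q) (up_add_le_prepend l x h hq) = mul l (x.init q hq) := by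
  have h1 := isPrefix_prepend l x h (d l + q) (up_add_le_prepend l x h hq)
  rw [init_congr x (q' := q) (by simp)] at h1
  refine h1.eq (isPrefix_refl _) ?_
  rw [d_init, d_mul (by rw [h, r_init]), d_init]

lemma prepend_init (l : Λ.Path) (x : Λ.GraphMorphism)
    (h : s l = x.vertex 0 (up_zero_le _)) :
    (prepend l x h).init (d l) (up_le_prepend l x h) = l := by
  have h1 := isPrefix_prepend l x h (d l) (up_le_prepend l x h)
  exact h1.eq (isPrefix_mul (by rw [h, r_init])) (d_init _ _)

lemma shift_prepend (l : Λ.Path) (x : Λ.GraphMorphism)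
    (h : s l = x.vertex 0 (up_zero_le _)) :
    (prepend l x h).shift (d l) (up_le_prepend l x h) = x := by
  have hdeg : up (d l) + x.deg - up (d l) = x.deg := by
    ext1 i
    exact (ENat.addLECancellable_of_ne_top (ENat.natCast_ne_top _)).add_tsub_cancel_left
  refine ext_init hdeg fun q hq hq' => ?_
  have h1 := init_shift (x := prepend l x h) (n := d l) (up_le_prepend l x h) (q := q)  hq
  rw [prepend_init, prepend_init_add l x h q hq'] at h1
  exact (fact_unique h1.1 (by rw [h, r_init]) h1.2 rfl).2

lemma prepend_shift (n : Fin k → ℕ) (x : Λ.GraphMorphism) (hn : up n ≤ x.deg)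
    (h : s (x.init n hn) = (x.shift n hn).vertex 0 (up_zero_le _)) :
    prepend (x.init n hn) (x.shift n hn) h = x := by
  have hd : d (x.init n hn) = n := d_init _ _
  refine ext_init ?_ fun q hq hq' => ?_
  · rw [prepend_deg, hd]
    exact add_tsub_cancel_of_le hn
  · have h1 := isPrefix_prepend _ _ h q hq
    have h2 := (init_shift hn (q := q - d (x.init n hn)) (up_sub_le hq)).2
    rw [h2] at h1
    refine h1.eq (x.isPrefix_init ?_ _) ?_
    · rw [hd]; exact le_add_tsub
    · rw [d_init, d_init]

end Prepend

/-- The boundary paths: `x` is a boundary path if for all `n ≤ d(x)` and all finite exhaustive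
`E ⊆ x(n)Λ` there is `λ ∈ E` with `x(n, n + d(λ)) = λ`. -/
def IsBoundary {Λ : KGraph k} (x : Λ.GraphMorphism) : Prop :=
  ∀ (n : Fin k → ℕ) (hn : up n ≤ x.deg) (E : Finset Λ.Path),
    IsFiniteExhaustive (x.vertex n hn) E →
      ∃ l ∈ E, ∃ h : up (n + d l) ≤ x.deg, x.seg n (n + d l) le_self_add h = l

/-- The boundary-path space `∂Λ`. -/
abbrev Boundary (Λ : KGraph k) : Type _ := {x : Λ.GraphMorphism // IsBoundary x}

section

variable {Λ : KGraph k}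

lemma vertex_congr (x : Λ.GraphMorphism) {q q' : Fin k → ℕ} (hq : q = q') (h' : up q ≤ x.deg) :
    x.vertex q h' = x.vertex q' (hq ▸ h') := by
  subst hq; rfl

lemma IsBoundary.shift {x : Λ.GraphMorphism} (hx : IsBoundary x) (n : Fin k → ℕ)
    (hn : up n ≤ x.deg) : IsBoundary (x.shift n hn) := by
  intro p hp E hE
  obtain ⟨l, hl, h, e⟩ := hx (n + p) (up_add_le_of_le_sub hn hp) E hE
  refine ⟨l, hl, up_le_sub (by rwa [← add_assoc]), ?_⟩
  exact (x.seg_congr rfl (add_assoc _ _ _).symm _ _).trans e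

lemma IsBoundary.prepend [Λ.FinitelyAligned] {x : Λ.GraphMorphism} (hx : IsBoundary x)
    (l : Λ.Path) (h : s l = x.vertex 0 (up_zero_le _)) : IsBoundary (prepend l x h) := by
  classical
  intro n hn E hE
  set y := KGraph.prepend l x h with hy
  -- the segment from `n` to `p = n ∨ d(l)`
  have hp : up (n ⊔ d l) ≤ y.deg := by
    rw [up_sup]; exact sup_le hn (up_le_prepend l x h)
  set a := y.seg n (n ⊔ d l) le_sup_left hp with ha
  have hra : r a = y.vertex n hn := r_seg _ _ _
  obtain ⟨p', hp'⟩ : ∃ p', n ⊔ d l = d l + p' :=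
    ⟨n ⊔ d l - d l, (add_tsub_cancel_of_le le_sup_right).symm⟩
  have hxp : up p' ≤ x.deg := by
    have : up (n ⊔ d l) ≤ up (d l) + x.deg := hp
    have h2 := up_sub_le this
    rwa [hp', add_tsub_cancel_left] at h2
  have hsa : s a = x.vertex p' hxp := by
    rw [ha, s_seg', ← s_init, init_congr y hp', prepend_init_add l x h p' hxp,
      s_mul (by rw [h, r_init]), s_init]
  let F : Finset Λ.Path := E.biUnion fun ν =>
    (FinitelyAligned.finite_minExt a ν).toFinset.image Prod.fst
  have hF : IsFiniteExhaustive (x.vertex p' hxp) F := by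
    constructor
    · intro α hα
      simp only [F, Finset.mem_biUnion, Finset.mem_image, Set.Finite.mem_toFinset] at hα
      obtain ⟨ν, -, ⟨α', β⟩, hm, rfl⟩ := hα
      rw [← hsa]; exact hm.1.symm
    · intro μ hμ
      have hsμ : s a = r μ := by rw [hsa, hμ]
      obtain ⟨ν, hν, ⟨β, δ⟩, h1, h2, h3, -⟩ := hE.2 (mul a μ) (by rw [r_mul hsμ, hra])
      dsimp only at h1 h2 h3
      rw [s_mul hsμ] at h2
      rw [mul_assoc' hsμ h2] at h3
      obtain ⟨α, β', c, hm, h4, h5, h6, h7⟩ := exists_minExt (l := a) (m := ν)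
        (by rw [r_mul h2, hsμ]) h1 h3.symm
      refine ⟨α, ?_, ?_⟩
      · simp only [F, Finset.mem_biUnion, Finset.mem_image, Set.Finite.mem_toFinset]
        exact ⟨ν, hν, ⟨α, β'⟩, hm, rfl⟩
      · obtain ⟨a1, b1, c1, hm1, -⟩ := exists_minExt h4 h2 h6
        exact ⟨_, hm1⟩
  obtain ⟨α, hα, hd, e⟩ := hx p' hxp F hF
  simp only [F, Finset.mem_biUnion, Finset.mem_image, Set.Finite.mem_toFinset] at hα
  obtain ⟨ν, hν, ⟨α', β⟩, ⟨h1, h2, h3, h4⟩, rfl⟩ := hα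
  dsimp only at *
  -- `y(0, n) a α' = y(0, n ∨ d(l) + d(α'))`
  have hle : up (n ⊔ d l + d α') ≤ y.deg := by
    rw [hp', add_assoc]; exact up_add_le_prepend l x h hd
  have e1 : mul (y.init n hn) (mul a α') = y.init (n ⊔ d l + d α') hle := by
    rw [← mul_assoc' (by rw [s_init, hra]) h1, ha, y.init_mul_seg, init_congr y hp' hp,
      prepend_init_add l x h p' hxp]
    rw [init_congr y (by rw [hp', add_assoc] : _ = d l + (p' + d α')),
      prepend_init_add l x h _ hd]
    conv_lhs => rw [← e]
    rw [mul_assoc' (by rw [h, r_init]) (by rw [s_init, r_seg]), x.init_mul_seg]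
  have hnν : IsPrefix (mul (y.init n hn) ν) (y.init (n ⊔ d l + d α') hle) := by
    rw [← e1, h3]
    exact (isPrefix_mul h2).mul_left (by rw [s_init, hE.1 ν hν])
  have hrν : s (y.init n hn) = r ν := by rw [s_init, hE.1 ν hν]
  have hdn : d (mul (y.init n hn) ν) = n + d ν := by rw [d_mul hrν, d_init]
  have hle2 : n + d ν ≤ n ⊔ d l + d α' := by
    have := hnν.d_le
    rwa [hdn, d_init] at this
  refine ⟨ν, hν, (up_le_up.2 hle2).trans hle, ?_⟩
  refine y.seg_eq_of_mul _ _ hrν ?_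
  exact hnν.eq (y.isPrefix_init hle2 hle) (by rw [hdn, d_init])

end

section Topology

variable {Λ : KGraph k}

/-- The cylinder set `D_λ = {x ∈ ∂Λ : x(0, d(λ)) = λ}`. -/
def D (l : Λ.Path) : Set Λ.Boundary :=
  {x | ∃ h : up (d l) ≤ x.1.deg, x.1.seg 0 (d l) zero_le h = l}

/-- The topology of `∂Λ`, with the basis of all sets `D_λ ∖ ⋃_{ν ∈ F} D_{λν}`, for `λ ∈ Λ` and
`F ⊆ s(λ)Λ` finite. -/
instance : TopologicalSpace Λ.Boundary :=
  TopologicalSpace.generateFrom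
    {U | ∃ (l : Λ.Path) (F : Finset Λ.Path), (∀ ν ∈ F, s l = r ν) ∧
      U = D l \ ⋃ ν ∈ F, D (mul l ν)}

/-- The range `r(x) = x(0)` of a boundary path. -/
def rg (x : Λ.Boundary) : Λ.Vertex := x.1.vertex 0 (up_zero_le _)

lemma mem_D {l : Λ.Path} {x : Λ.Boundary} :
    x ∈ D l ↔ ∃ h : up (d l) ≤ x.1.deg, x.1.init (d l) h = l := Iff.rfl

lemma mem_D_of_isPrefix {l : Λ.Path} {x : Λ.Boundary} {q : Fin k → ℕ} (hq : up q ≤ x.1.deg)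
    (h : IsPrefix l (x.1.init q hq)) : x ∈ D l := by
  have hle := h.d_le
  rw [d_init] at hle
  refine mem_D.2 ⟨(up_le_up.2 hle).trans hq, ?_⟩
  exact ((x.1.isPrefix_init hle hq).eq h (d_init _ _))

lemma isPrefix_of_mem_D {l : Λ.Path} {x : Λ.Boundary} (hx : x ∈ D l) {q : Fin k → ℕ}
    (hq : up q ≤ x.1.deg) (hle : d l ≤ q) : IsPrefix l (x.1.init q hq) := by
  obtain ⟨h, e⟩ := mem_D.1 hx
  have := x.1.isPrefix_init hle hq
  rwa [e] at this

lemma mem_D_init (x : Λ.Boundary) {q : Fin k → ℕ} (hq : up q ≤ x.1.deg) :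
    x ∈ D (x.1.init q hq) := mem_D_of_isPrefix hq (isPrefix_refl _)

lemma r_of_mem_D {l : Λ.Path} {x : Λ.Boundary} (hx : x ∈ D l) : r l = rg x := by
  obtain ⟨h, e⟩ := mem_D.1 hx
  rw [← e, r_init]; rfl

lemma mem_D_of_mul {l m : Λ.Path} (h : s l = r m) {x : Λ.Boundary} (hx : x ∈ D (mul l m)) :
    x ∈ D l := by
  obtain ⟨hd, e⟩ := mem_D.1 hx
  refine mem_D_of_isPrefix hd ?_
  rw [e]; exact isPrefix_mul h

lemma mem_D_id {v : Λ.Vertex} {x : Λ.Boundary} : x ∈ D (idPath v) ↔ rg x = v := by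
  constructor
  · intro h; exact (r_of_mem_D h).symm
  · rintro rfl
    have h0 : d (x.1.init 0 (up_zero_le _)) = 0 := d_init _ _
    have := eq_id_of_d_eq_zero h0
    rw [r_init] at this
    have h1 := mem_D_init x (up_zero_le _)
    rwa [this] at h1

lemma isOpen_diff (l : Λ.Path) (F : Finset Λ.Path) (hF : ∀ ν ∈ F, s l = r ν) :
    IsOpen (D l \ ⋃ ν ∈ F, D (mul l ν)) :=
  TopologicalSpace.isOpen_generateFrom_of_mem ⟨l, F, hF, rfl⟩

lemma isOpen_D (l : Λ.Path) : IsOpen (D l) := by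
  have := isOpen_diff l ∅ (by simp)
  simpa using this

lemma isClopen_D (l : Λ.Path) : IsClopen (D l) := by
  refine ⟨⟨?_⟩, isOpen_D l⟩
  rw [isOpen_iff_forall_mem_open]
  intro x hx
  by_cases h : rg x = r l
  · refine ⟨_, ?_, isOpen_diff (idPath (r l)) {l} (by simp), ?_⟩
    · intro y hy
      simp only [Finset.mem_singleton, iUnion_iUnion_eq_left, id_mul] at hy
      exact hy.2
    · simp only [Finset.mem_singleton, iUnion_iUnion_eq_left, id_mul]
      exact ⟨mem_D_id.2 h, hx⟩
  · refine ⟨D (idPath (rg x)), ?_, isOpen_D _, mem_D_id.2 rfl⟩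
    intro y hy hy'
    exact h (((mem_D_id.1 hy).symm.trans (r_of_mem_D hy').symm))

lemma continuous_of_isClopen {Y : Type*} [TopologicalSpace Y] {f : Y → Λ.Boundary}
    (h : ∀ l, IsClopen (f ⁻¹' D l)) : Continuous f := by
  refine continuous_generateFrom_iff.2 ?_
  rintro _ ⟨l, F, -, rfl⟩
  rw [preimage_sdiff, preimage_iUnion₂]
  refine (h l).isOpen.sdiff ?_
  exact F.finite_toSet.isClosed_biUnion fun ν _ => (h _).isClosed

lemma eq_of_forall_mem_D {x y : Λ.Boundary} (h : ∀ l, x ∈ D l ↔ y ∈ D l) : x = y := by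
  have key : ∀ (x y : Λ.Boundary), (∀ l, x ∈ D l → y ∈ D l) → ∀ q (hq : up q ≤ x.1.deg),
      ∃ hy : up q ≤ y.1.deg, y.1.init q hy = x.1.init q hq := by
    intro x y h q hq
    obtain ⟨h1, h2⟩ := mem_D.1 (h _ (mem_D_init x hq))
    have e : d (x.1.init q hq) = q := d_init _ _
    refine ⟨by rwa [e] at h1, ?_⟩
    rwa [init_congr y.1 e] at h2
  have hle : ∀ (x y : Λ.Boundary), (∀ l, x ∈ D l → y ∈ D l) → x.1.deg ≤ y.1.deg := by
    intro x y h i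
    refine ENat.forall_natCast_le_iff_le.1 fun a ha => ?_
    classical
    have h1 : up (Pi.single i a) ≤ x.1.deg := by
      intro j
      by_cases hj : j = i
      · subst hj; simpa [up] using ha
      · simp [up, hj]
    have h2 := (key x y h _ h1).1 i
    simpa [up] using h2
  refine Subtype.ext (ext_init (le_antisymm (hle x y fun l => (h l).1) (hle y x fun l => (h l).2))
    fun q hx hy => ?_)
  exact (key x y (fun l => (h l).1) q hx).2.symm

instance : T2Space Λ.Boundary := by
  refine ⟨fun x y hxy => ?_⟩
  by_contra hcon
  refine hxy (eq_of_forall_mem_D fun l => ?_)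
  by_contra hne
  rcases (by tauto : (x ∈ D l ∧ y ∉ D l) ∨ (x ∉ D l ∧ y ∈ D l)) with ⟨h1, h2⟩ | ⟨h1, h2⟩
  · exact hcon ⟨D l, (D l)ᶜ, isOpen_D l, (isClopen_D l).compl.isOpen, h1, h2, disjoint_compl_right⟩
  · exact hcon ⟨(D l)ᶜ, D l, (isClopen_D l).compl.isOpen, isOpen_D l, h1, h2, disjoint_compl_left⟩

end Topology

/-- The space `∂Λ^{≥n}` of boundary paths of degree at least `n`. -/
abbrev BoundaryGE (Λ : KGraph k) (n : Fin k → ℕ) : Type _ := {x : Λ.Boundary // up n ≤ x.1.deg}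

section Shift

variable {Λ : KGraph k} {n : Fin k → ℕ}

/-- The shift `σ_n : ∂Λ^{≥n} → ∂Λ`. -/
def σ (n : Fin k → ℕ) (x : Λ.BoundaryGE n) : Λ.Boundary :=
  ⟨x.1.1.shift n x.2, x.1.2.shift n x.2⟩

/-- The initial segment `x(0, n)` of `x ∈ ∂Λ^{≥n}`. -/
def head (x : Λ.BoundaryGE n) : Λ.Path := x.1.1.init n x.2

lemma d_head (x : Λ.BoundaryGE n) : d (head x) = n := d_init _ _

lemma mem_D_head (x : Λ.BoundaryGE n) : x.1 ∈ D (head x) := mem_D_init _ _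

lemma head_eq_of_mem_D {x : Λ.BoundaryGE n} {a : Λ.Path} (ha : d a = n) (h : x.1 ∈ D a) :
    head x = a := by
  subst ha
  exact (mem_D.1 h).2

lemma s_head (x : Λ.BoundaryGE n) : s (head x) = rg (σ n x) := by
  have := (init_shift x.2 (q := 0) (up_zero_le _)).1
  exact this.trans (r_init _ _)

lemma σ_mem_D {x : Λ.BoundaryGE n} {l : Λ.Path} :
    σ n x ∈ D l ↔ s (head x) = r l ∧ x.1 ∈ D (mul (head x) l) := by
  constructor
  · intro h
    have hs : s (head x) = r l := by rw [s_head, r_of_mem_D h]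
    obtain ⟨h1, h2⟩ := mem_D.1 h
    refine ⟨hs, ?_⟩
    have h3 := (init_shift x.2 h1).2
    refine mem_D_of_isPrefix (up_add_le_of_le_sub x.2 h1) ?_
    rw [← h3]
    have h4 : (x.1.1.shift n x.2).init (d l) h1 = l := h2
    rw [h4]
    exact isPrefix_refl _
  · rintro ⟨hs, h⟩
    obtain ⟨h1, h2⟩ := mem_D.1 h
    have e : d (mul (head x) l) = n + d l := by rw [d_mul hs, d_head]
    rw [e] at h1
    rw [init_congr x.1.1 e] at h2
    refine mem_D.2 ⟨up_le_sub h1, ?_⟩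
    have h3 := init_shift x.2 (up_le_sub h1)
    rw [h2] at h3
    exact (fact_unique h3.1 hs h3.2 rfl).2

lemma continuous_val : Continuous (fun x : Λ.BoundaryGE n => x.1) := continuous_subtype_val

lemma isClopen_head (a : Λ.Path) : IsClopen {x : Λ.BoundaryGE n | head x = a} := by
  by_cases ha : d a = n
  · have : {x : Λ.BoundaryGE n | head x = a} = (fun x : Λ.BoundaryGE n => x.1) ⁻¹' D a := by
      ext x
      exact ⟨fun h => by rw [mem_preimage, ← (h : head x = a)]; exact mem_D_head x,
        fun h => head_eq_of_mem_D ha h⟩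
    rw [this]
    exact (isClopen_D a).preimage continuous_val
  · convert isClopen_empty
    ext x
    simp only [mem_ofPred_eq, mem_empty_iff_false, iff_false]
    rintro rfl
    exact ha (d_head x)

lemma continuous_σ : Continuous (σ n : Λ.BoundaryGE n → Λ.Boundary) := by
  refine continuous_of_isClopen fun l => ?_
  have key : ∀ S : Set (Λ.BoundaryGE n), (∀ a, IsOpen (S ∩ {x | head x = a})) → IsOpen S := by
    intro S hS
    have : S = ⋃ a, S ∩ {x | head x = a} := by
      ext x; simp
    rw [this]
    exact isOpen_iUnion hS
  have hcl : ∀ a, IsClopen ((σ n ⁻¹' D l) ∩ {x : Λ.BoundaryGE n | head x = a}) := by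
    intro a
    by_cases h : s a = r l
    · have : (σ n ⁻¹' D l) ∩ {x : Λ.BoundaryGE n | head x = a} =
          ((fun x : Λ.BoundaryGE n => x.1) ⁻¹' D (mul a l)) ∩ {x | head x = a} := by
        ext x
        constructor
        · rintro ⟨h1, rfl⟩
          exact ⟨(σ_mem_D.1 h1).2, rfl⟩
        · rintro ⟨h1, rfl⟩
          exact ⟨σ_mem_D.2 ⟨h, h1⟩, rfl⟩
      rw [this]
      exact ((isClopen_D _).preimage continuous_val).inter (isClopen_head a)
    · convert isClopen_empty
      ext x
      simp only [mem_inter_iff, mem_preimage, mem_ofPred_eq, mem_empty_iff_false, iff_false]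
      rintro ⟨h1, rfl⟩
      exact h (σ_mem_D.1 h1).1
  refine ⟨⟨key _ fun a => ?_⟩, key _ fun a => (hcl a).isOpen⟩
  have : (σ n ⁻¹' D l)ᶜ ∩ {x : Λ.BoundaryGE n | head x = a} =
      ((σ n ⁻¹' D l) ∩ {x : Λ.BoundaryGE n | head x = a})ᶜ ∩ {x | head x = a} := by
    ext x
    simp only [mem_inter_iff, mem_compl_iff, mem_ofPred_eq]
    tauto
  rw [this]
  exact (hcl a).compl.isOpen.inter (isClopen_head a).isOpen

lemma ext_σ {x y : Λ.BoundaryGE n} (h : head x = head y) (h' : σ n x = σ n y) : x = y := by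
  have hs : ∀ z : Λ.BoundaryGE n, s (z.1.1.init n z.2) = (z.1.1.shift n z.2).vertex 0 (up_zero_le _)
    := fun z => s_head z
  have hx := prepend_shift n x.1.1 x.2 (hs x)
  have hy := prepend_shift n y.1.1 y.2 (hs y)
  have h1 : x.1.1.init n x.2 = y.1.1.init n y.2 := h
  have h2 : x.1.1.shift n x.2 = y.1.1.shift n y.2 := congrArg Subtype.val h'
  refine Subtype.ext (Subtype.ext ?_)
  rw [← hx, ← hy]
  congr 1

variable [Λ.FinitelyAligned]

/-- The boundary path `λx`, for `d(λ) = n` and `s(λ) = r(x)`. -/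
noncomputable def lift (n : Fin k → ℕ) (l : Λ.Path) (hl : d l = n)
    (x : {x : Λ.Boundary // s l = rg x}) : Λ.BoundaryGE n :=
  ⟨⟨prepend l x.1.1 x.2, x.1.2.prepend l x.2⟩, by rw [← hl]; exact up_le_prepend l x.1.1 x.2⟩

lemma head_lift {l : Λ.Path} (hl : d l = n) (x : {x : Λ.Boundary // s l = rg x}) :
    head (lift n l hl x) = l := by
  subst hl
  exact prepend_init l x.1.1 x.2

lemma σ_lift {l : Λ.Path} (hl : d l = n) (x : {x : Λ.Boundary // s l = rg x}) :
    σ n (lift n l hl x) = x.1 := by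
  subst hl
  exact Subtype.ext (shift_prepend l x.1.1 x.2)

lemma lift_head (y : Λ.BoundaryGE n) :
    lift n (head y) (d_head y) ⟨σ n y, s_head y⟩ = y :=
  ext_σ (head_lift _ _) (σ_lift _ _)

lemma lift_mem_D {l : Λ.Path} (hl : d l = n) {x : {x : Λ.Boundary // s l = rg x}}
    {m : Λ.Path} : (lift n l hl x).1 ∈ D m ↔ ∃ p ∈ minExt l m, x.1 ∈ D p.1 := by
  subst hl
  obtain ⟨x, hx⟩ := x
  have hx0 : s l = x.1.vertex 0 (up_zero_le _) := hx
  constructor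
  · intro h
    have hd := (mem_D.1 h).1
    have hle : up (d l + (d m - d l)) ≤ (prepend l x.1 hx0).deg := by
      have : d l + (d m - d l) = d l ⊔ d m := by
        ext i; simp only [Pi.add_apply, Pi.sub_apply, Pi.sup_apply]; omega
      rw [this, up_sup]
      exact sup_le (up_le_prepend _ _ _) hd
    have hq : up (d m - d l) ≤ x.1.deg := by
      have := up_sub_le (n := d l) hle
      rwa [add_tsub_cancel_left] at this
    have h1 := isPrefix_of_mem_D h hle (by exact le_add_tsub)
    have h2 := prepend_init_add l x.1 hx0 _ hq
    have h3 : IsPrefix m (mul l (x.1.init _ hq)) := by rw [← h2]; exact h1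
    obtain ⟨b, hb, e⟩ := h3
    have hs : s l = r (x.1.init (d m - d l) hq) := by rw [hx0, r_init]
    refine ⟨(x.1.init _ hq, b), ⟨hs, hb, e.symm, ?_⟩, mem_D_init _ _⟩
    rw [d_mul hs, d_init]
    ext i; simp only [Pi.add_apply, Pi.sub_apply, Pi.sup_apply]; omega
  · rintro ⟨⟨a, b⟩, ⟨h1, h2, h3, -⟩, h⟩
    obtain ⟨hd, e⟩ := mem_D.1 h
    dsimp only at *
    have h4 := prepend_init_add l x.1 hx0 _ hd
    refine mem_D_of_isPrefix (x := (lift (d l) l rfl ⟨x, hx⟩).1)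
      (up_add_le_prepend l x.1 hx0 hd) ?_
    have h5 : IsPrefix m ((prepend l x.1 hx0).init (d l + d a)
        (up_add_le_prepend l x.1 hx0 hd)) := by
      rw [h4, e, h3]; exact isPrefix_mul h2
    exact h5

lemma continuous_lift {l : Λ.Path} (hl : d l = n) : Continuous (lift n l hl) := by
  refine Continuous.subtype_mk (continuous_of_isClopen (f := fun x => (lift n l hl x).1)
    fun m => ?_) _
  have : (fun x => (lift n l hl x).1) ⁻¹' D m =
      ⋃ p ∈ minExt l m, (fun x : {x : Λ.Boundary // s l = rg x} => x.1) ⁻¹' D p.1 := by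
    ext x
    simp only [mem_preimage, lift_mem_D hl, mem_iUnion, exists_prop]
  rw [this]
  exact (FinitelyAligned.finite_minExt l m).isClopen_biUnion
    fun p _ => (isClopen_D _).preimage continuous_subtype_val

end Shift

end KGraph

/-! ### Hilbert modules -/

namespace HilbertModule

section

variable {A E : Type*} [NonUnitalCommCStarAlgebra A] [PartialOrder A] [StarOrderedRing A]
  [NormedAddCommGroup E] [NormedSpace ℂ E] [SMul A E] [CStarModule A E]

variable (A) in
lemma ext_inner {x y : E} (h : ∀ z : E, inner A z x = inner A z y) : x = y := by
  rw [← sub_eq_zero, ← CStarModule.inner_self (A := A), CStarModule.inner_sub_right, h, sub_self]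

lemma smul_add' (a : A) (x y : E) : a • (x + y) = a • x + a • y :=
  ext_inner A fun z => by simp [mul_add]

lemma add_smul' (a b : A) (x : E) : (a + b) • x = a • x + b • x :=
  ext_inner A fun z => by simp [add_mul]

lemma complex_smul_smul (c : ℂ) (a : A) (x : E) : (c • a) • x = c • a • x :=
  ext_inner A fun z => by simp [smul_mul_assoc]

lemma norm_smul_le' (a : A) (x : E) : ‖a • x‖ ≤ ‖a‖ * ‖x‖ := by
  refine le_of_sq_le_sq ?_ (by positivity)
  rw [CStarModule.norm_sq_eq A (x := a • x), mul_pow, CStarModule.norm_sq_eq A (x := x)]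
  simp only [CStarModule.inner_op_smul_right, CStarModule.inner_op_smul_left]
  calc ‖a * (inner A x x * star a)‖ ≤ ‖a‖ * (‖inner A x x‖ * ‖star a‖) :=
        (norm_mul_le _ _).trans (by gcongr; exact norm_mul_le _ _)
    _ = ‖a‖ ^ 2 * ‖inner A x x‖ := by rw [norm_star]; ring

lemma uniformContinuousConstSMul : UniformContinuousConstSMul A E := by
  refine ⟨fun a => ?_⟩
  let f : E →+ E := ⟨⟨fun x => a • x, by
    have := smul_add' a (0 : E) 0
    simpa using this⟩, smul_add' a⟩
  exact (AddMonoidHomClass.lipschitz_of_bound f ‖a‖ (norm_smul_le' a)).uniformContinuous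

variable (A) in
/-- The rank-one operator `Θ_{x,y}(z) = x · ⟨y, z⟩`. -/
noncomputable def rankOne (x y : E) : E →L[ℂ] E :=
  LinearMap.mkContinuous
    { toFun := fun z => (inner A y z : A) • x
      map_add' := fun z w => by rw [CStarModule.inner_add_right, add_smul']
      map_smul' := fun c z => by
        rw [CStarModule.inner_smul_right_complex, complex_smul_smul]; rfl }
    (‖y‖ * ‖x‖) (fun z => by
      refine (norm_smul_le' _ _).trans ?_
      have := CStarModule.norm_inner_le (A := A) E (x := y) (y := z)
      calc _ ≤ ‖y‖ * ‖z‖ * ‖x‖ := by gcongr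
        _ = _ := by ring)

lemma rankOne_apply (x y z : E) : rankOne A x y z = (inner A y z : A) • x := rfl

variable (A E) in
/-- The compact operators `𝒦(E)` on a Hilbert module: the closed linear span of the rank-one
operators. -/
noncomputable def compactOperators : Submodule ℂ (E →L[ℂ] E) :=
  (Submodule.span ℂ {T | ∃ x y : E, T = rankOne A x y}).topologicalClosure

variable (A) in
/-- `T` is adjointable, i.e. `T ∈ ℒ(E)`. -/
def IsAdjointable (T : E →L[ℂ] E) : Prop :=
  ∃ T' : E →L[ℂ] E, ∀ x y : E, (inner A (T x) y : A) = inner A x (T' y)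

end

section Completion

open UniformSpace

variable {A E : Type*} [NonUnitalCommCStarAlgebra A] [PartialOrder A] [StarOrderedRing A]
  [NormedAddCommGroup E] [NormedSpace ℂ E] [SMul A E] [CStarModule A E]

lemma inner_coe (x y : E) : (inner A (x : Completion E) (y : Completion E) : A) = inner A x y :=
  (Completion.isDenseInducing_coe.prodMap Completion.isDenseInducing_coe).extend_eq
    (CStarModule.continuous_inner : Continuous fun p : E × E => (inner A p.1 p.2 : A)) (x, y)

lemma continuous_inner_completion :
    Continuous fun p : Completion E × Completion E => (inner A p.1 p.2 : A) := by
  let inner' : E →+ E →+ A :=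
    { toFun := fun x => (CStarModule.innerₛₗ (A := A) x).toAddMonoidHom
      map_zero' := by ext x; exact CStarModule.inner_zero_left
      map_add' := fun x y => by ext z; exact CStarModule.inner_add_left }
  have : Continuous fun p : E × E => inner' p.1 p.2 :=
    (CStarModule.continuous_inner : Continuous fun p : E × E => (inner A p.1 p.2 : A))
  exact (Completion.isDenseInducing_toCompl E).extend_Z_bilin
    (Completion.isDenseInducing_toCompl E) this

lemma Continuous.inner_completion {α : Type*} [TopologicalSpace α] {f g : α → Completion E}
    (hf : Continuous f) (hg : Continuous g) : Continuous fun x => (inner A (f x) (g x) : A) :=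
  continuous_inner_completion.comp (hf.prodMk hg)

lemma inner_self_completion (x : Completion E) : ‖x‖ = √‖(inner A x x : A)‖ := by
  induction x using Completion.induction_on with
  | hp =>
    exact isClosed_eq continuous_norm
      (Real.continuous_sqrt.comp (Continuous.inner_completion continuous_id continuous_id).norm)
  | ih x => rw [inner_coe, Completion.norm_coe, CStarModule.norm_eq_sqrt_norm_inner_self (A := A)]

variable [UniformContinuousConstSMul A E]

/-- The completion of a pre-Hilbert module is a Hilbert module, with the inner product and the
action of the coefficient algebra extended by continuity. -/
noncomputable instance : CStarModule A (Completion E) where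
  inner_add_right {x y z} := by
    induction x, y, z using Completion.induction_on₃ with
    | hp =>
      exact isClosed_eq
        (Continuous.inner_completion continuous_fst (continuous_snd.fst.add continuous_snd.snd))
        ((Continuous.inner_completion continuous_fst continuous_snd.fst).add
          (Continuous.inner_completion continuous_fst continuous_snd.snd))
    | ih x y z => rw [← Completion.coe_add]; simp only [inner_coe, CStarModule.inner_add_right]
  inner_self_nonneg {x} := by
    induction x using Completion.induction_on with
    | hp =>
      exact isClosed_le continuous_const (Continuous.inner_completion continuous_id continuous_id)
    | ih x => rw [inner_coe]; exact CStarModule.inner_self_nonneg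
  inner_self {x} := by
    have h := inner_self_completion (A := A) x
    constructor
    · intro h0
      rw [h0, norm_zero, Real.sqrt_zero] at h
      exact norm_eq_zero.1 h
    · rintro rfl
      rw [norm_zero] at h
      exact norm_eq_zero.1 ((Real.sqrt_eq_zero (norm_nonneg _)).1 h.symm)
  inner_op_smul_right {a x y} := by
    induction x, y using Completion.induction_on₂ with
    | hp =>
      exact isClosed_eq (Continuous.inner_completion continuous_fst
          ((uniformContinuous_const_smul a).continuous.comp continuous_snd))
        (continuous_const.mul (Continuous.inner_completion continuous_fst continuous_snd))
    | ih x y =>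
      rw [← Completion.coe_smul]; simp only [inner_coe, CStarModule.inner_op_smul_right]
  inner_smul_right_complex {c x y} := by
    induction x, y using Completion.induction_on₂ with
    | hp =>
      exact isClosed_eq (Continuous.inner_completion continuous_fst (continuous_snd.const_smul c))
        ((Continuous.inner_completion continuous_fst continuous_snd).const_smul c)
    | ih x y =>
      rw [← Completion.coe_smul]; simp only [inner_coe, CStarModule.inner_smul_right_complex]
  star_inner x y := by
    induction x, y using Completion.induction_on₂ with
    | hp =>
      exact isClosed_eq (continuous_star.comp
        (Continuous.inner_completion continuous_fst continuous_snd))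
        (Continuous.inner_completion continuous_snd continuous_fst)
    | ih x y => simp only [inner_coe, CStarModule.star_inner]
  norm_eq_sqrt_norm_inner_self x := inner_self_completion x

end Completion

end HilbertModule

/-! ### The pointwise order of `C₀(X)` -/

namespace ZeroAtInftyContinuousMap

open scoped ComplexOrder

variable {X : Type*} [TopologicalSpace X]

/-- The pointwise order on `C₀(X)`. -/
noncomputable instance instPartialOrderComplex : PartialOrder C₀(X, ℂ) :=
  PartialOrder.lift (fun f => (f : X → ℂ)) DFunLike.coe_injective

lemma complex_le_def {f g : C₀(X, ℂ)} : f ≤ g ↔ ∀ x, f x ≤ g x := Iff.rfl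

instance instStarOrderedRingComplex : StarOrderedRing C₀(X, ℂ) := by
  refine StarOrderedRing.of_nonneg_iff' (fun {f g} h z x => ?_) fun f => ?_
  · exact add_le_add_right (h x) _
  · constructor
    · intro h
      have h' : ∀ x, (0 : ℂ) ≤ f x := h
      let F : ℂ → ℂ := fun z => ((√‖z‖ : ℝ) : ℂ)
      have hF : Continuous F := by fun_prop
      have hF0 : F 0 = 0 := by simp [F]
      refine ⟨⟨⟨fun x => F (f x), hF.comp f.continuous⟩, ?_⟩, ?_⟩
      · have := (hF.tendsto 0).comp (zero_at_infty f)
        rwa [hF0] at this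
      · ext x
        change f x = star (F (f x)) * F (f x)
        simp only [F, RCLike.star_def, Complex.conj_ofReal]
        rw [← Complex.ofReal_mul, Real.mul_self_sqrt (norm_nonneg _)]
        exact (Complex.norm_of_nonneg' (h' x)).symm
    · rintro ⟨g, rfl⟩ x
      change (0 : ℂ) ≤ star (g x) * g x
      exact star_mul_self_nonneg _

end ZeroAtInftyContinuousMap

namespace KGraph

variable {k : ℕ}

section Fibre

variable {Λ : KGraph k} {n : Fin k → ℕ}

/-- The sum `∑_{σ_n(y) = x} u(y)` of a function over a fibre of `σ_n`. -/
noncomputable def fibreSum (n : Fin k → ℕ) (u : Λ.BoundaryGE n → ℂ) (x : Λ.Boundary) : ℂ :=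
  ∑' y : {y : Λ.BoundaryGE n // σ n y = x}, u y.1

lemma exists_finset_head (u : C_c(Λ.BoundaryGE n, ℂ)) :
    ∃ I : Finset Λ.Path, ∀ y, u y ≠ 0 → head y ∈ I := by
  obtain ⟨I, hI⟩ := (u.hasCompactSupport : IsCompact (tsupport u)).elim_finite_subcover
    (fun a : Λ.Path => {x : Λ.BoundaryGE n | head x = a}) (fun a => (isClopen_head a).isOpen)
    (fun y _ => mem_iUnion.2 ⟨head y, rfl⟩)
  refine ⟨I, fun y hy => ?_⟩
  have := hI (subset_tsupport u hy)
  simp only [mem_iUnion, exists_prop] at this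
  obtain ⟨a, ha, h⟩ := this
  rw [(h : head y = a)]
  exact ha

lemma finite_support_fibre (u : C_c(Λ.BoundaryGE n, ℂ)) (x : Λ.Boundary) :
    (Function.support fun y : {y : Λ.BoundaryGE n // σ n y = x} => u y.1).Finite := by
  obtain ⟨I, hI⟩ := exists_finset_head u
  refine Set.Finite.of_finite_image (f := fun y => head y.1)
    (I.finite_toSet.subset ?_) ?_
  · rintro _ ⟨y, hy, rfl⟩
    exact hI _ hy
  · intro y _ z _ h
    exact Subtype.ext (ext_σ h (y.2.trans z.2.symm))

lemma summable_fibre (u : C_c(Λ.BoundaryGE n, ℂ)) (x : Λ.Boundary) :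
    Summable fun y : {y : Λ.BoundaryGE n // σ n y = x} => u y.1 :=
  summable_of_hasFiniteSupport (finite_support_fibre u x)

lemma fibreSum_eq_zero (u : C_c(Λ.BoundaryGE n, ℂ)) {x : Λ.Boundary}
    (hx : x ∉ σ n '' tsupport u) : fibreSum n u x = 0 := by
  have : ∀ y : {y : Λ.BoundaryGE n // σ n y = x}, u y.1 = 0 := fun y => by
    by_contra h
    exact hx ⟨y.1, subset_tsupport u h, y.2⟩
  simp [fibreSum, this]

variable [Λ.FinitelyAligned]

open Classical in
/-- The function `x ↦ u(λx)`, extended by zero. -/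
noncomputable def pull (u : Λ.BoundaryGE n → ℂ) (l : Λ.Path) (x : Λ.Boundary) : ℂ :=
  if h : d l = n ∧ s l = rg x then u (lift n l h.1 ⟨x, h.2⟩) else 0

lemma continuous_pull {u : Λ.BoundaryGE n → ℂ} (hu : Continuous u) (l : Λ.Path) :
    Continuous (pull u l) := by
  by_cases hl : d l = n
  · have hU : IsClopen {x : Λ.Boundary | s l = rg x} := by
      have : {x : Λ.Boundary | s l = rg x} = D (idPath (s l)) := by
        ext x; rw [mem_D_id]; exact eq_comm
      rw [this]; exact isClopen_D _
    have h1 : ContinuousOn (pull u l) {x : Λ.Boundary | s l = rg x} := by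
      rw [continuousOn_iff_continuous_domRestrict]
      have : ({x : Λ.Boundary | s l = rg x}.domRestrict (pull u l)) =
          fun x => u (lift n l hl x) := by
        ext x
        have hx : d l = n ∧ s l = rg x.1 := ⟨hl, x.2⟩
        exact dif_pos hx
      rw [this]
      exact hu.comp (continuous_lift hl)
    have h2 : ContinuousOn (pull u l) {x : Λ.Boundary | s l = rg x}ᶜ := by
      refine (continuousOn_const (c := (0 : ℂ))).congr fun x hx => ?_
      exact dif_neg fun h => hx h.2
    rw [← continuousOn_univ, ← union_compl_self {x : Λ.Boundary | s l = rg x}]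
    exact h1.union_of_isOpen h2 hU.isOpen hU.compl.isOpen
  · have : pull u l = fun _ => 0 := by ext x; simp [pull, hl]
    rw [this]; exact continuous_const

lemma fibreSum_eq_sum (u : C_c(Λ.BoundaryGE n, ℂ)) {I : Finset Λ.Path}
    (hI : ∀ y, u y ≠ 0 → head y ∈ I) (x : Λ.Boundary) :
    fibreSum n u x = ∑ l ∈ I, pull u l x := by
  let e : {y : Λ.BoundaryGE n // σ n y = x} ≃ {l : Λ.Path | d l = n ∧ s l = rg x} :=
    { toFun := fun y => ⟨head y.1, d_head y.1, by rw [s_head, y.2]⟩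
      invFun := fun l => ⟨lift n l.1 l.2.1 ⟨x, l.2.2⟩, σ_lift l.2.1 ⟨x, l.2.2⟩⟩
      left_inv := fun y => Subtype.ext (ext_σ (head_lift (d_head y.1) _)
        ((σ_lift (d_head y.1) ⟨x, (by rw [s_head, y.2])⟩).trans y.2.symm))
      right_inv := fun l => Subtype.ext (head_lift l.2.1 _) }
  have h1 : fibreSum n u x = ∑' l : {l : Λ.Path | d l = n ∧ s l = rg x}, pull u l.1 x := by
    rw [fibreSum, ← e.symm.tsum_eq]
    refine tsum_congr fun l => ?_
    have hl : d l.1 = n ∧ s l.1 = rg x := l.2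
    rw [pull, dif_pos hl]
    rfl
  rw [h1, tsum_subtype {l : Λ.Path | d l = n ∧ s l = rg x} (fun l => pull u l x),
    tsum_eq_sum (s := I)]
  · refine Finset.sum_congr rfl fun l _ => ?_
    rw [indicator_apply_eq_self]
    intro hl
    have hl : ¬ (d l = n ∧ s l = rg x) := hl
    rw [pull, dif_neg hl]
  · intro l hl
    refine indicator_apply_eq_zero.2 fun h => ?_
    have h : d l = n ∧ s l = rg x := h
    rw [pull, dif_pos h]
    by_contra hne
    have := hI _ hne
    rw [head_lift] at this
    exact hl this

/-- For `u ∈ C_c(∂Λ^{≥n})`, the function `x ↦ ∑_{σ_n(y) = x} u(y)` in `C₀(∂Λ)`. -/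
noncomputable def transfer (u : C_c(Λ.BoundaryGE n, ℂ)) : C₀(Λ.Boundary, ℂ) where
  toFun := fibreSum n u
  continuous_toFun := by
    obtain ⟨I, hI⟩ := exists_finset_head u
    rw [funext (fibreSum_eq_sum u hI)]
    exact continuous_finsetSum _ fun l _ => continuous_pull (map_continuous u) l
  zero_at_infty' := by
    have hK : IsCompact (σ n '' tsupport u) :=
      (u.hasCompactSupport : IsCompact (tsupport u)).image continuous_σ
    exact (HasCompactSupport.intro hK fun x hx => fibreSum_eq_zero u hx).is_zero_at_infty

lemma transfer_apply (u : C_c(Λ.BoundaryGE n, ℂ)) (x : Λ.Boundary) :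
    transfer u x = ∑' y : {y : Λ.BoundaryGE n // σ n y = x}, u y.1 := rfl

lemma transfer_add (u v : C_c(Λ.BoundaryGE n, ℂ)) :
    transfer (u + v) = transfer u + transfer v := by
  ext x
  exact (summable_fibre u x).tsum_add (summable_fibre v x)

lemma transfer_smul (c : ℂ) (u : C_c(Λ.BoundaryGE n, ℂ)) :
    transfer (c • u) = c • transfer u := by
  ext x
  exact tsum_mul_left

lemma transfer_star (u : C_c(Λ.BoundaryGE n, ℂ)) : transfer (star u) = star (transfer u) := by
  ext x
  exact (Complex.conj_tsum _).symm

end Fibre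

/-! ### The bimodules `X_n` -/

section Modules

variable (Λ : KGraph k) (n : Fin k → ℕ)

/-- The space `C_c(∂Λ^{≥n})`, which carries the inner product, the norm and the right action of
`C₀(∂Λ)` defined below. -/
def PreX : Type _ := C_c(Λ.BoundaryGE n, ℂ)

noncomputable instance : AddCommGroup (Λ.PreX n) :=
  inferInstanceAs (AddCommGroup C_c(Λ.BoundaryGE n, ℂ))

noncomputable instance : Module ℂ (Λ.PreX n) :=
  inferInstanceAs (Module ℂ C_c(Λ.BoundaryGE n, ℂ))

instance : FunLike (Λ.PreX n) (Λ.BoundaryGE n) ℂ :=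
  inferInstanceAs (FunLike C_c(Λ.BoundaryGE n, ℂ) (Λ.BoundaryGE n) ℂ)

variable {Λ n}

/-- A compactly supported continuous function as an element of the pre-Hilbert module. -/
def PreX.toCc (f : Λ.PreX n) : C_c(Λ.BoundaryGE n, ℂ) := f

@[ext] lemma PreX.ext {f g : Λ.PreX n} (h : ∀ x, f x = g x) : f = g := DFunLike.ext _ _ h

/-- The right action `(f · a)(x) = f(x) a(σ_n(x))` of `C₀(∂Λ)`. (Mathlib writes the action of the
coefficient algebra of a Hilbert module as a scalar multiplication `a • f`.) -/
noncomputable instance : SMul C₀(Λ.Boundary, ℂ) (Λ.PreX n) where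
  smul a f := (⟨⟨fun x => f x * a (σ n x),
    (map_continuous f.toCc).mul ((map_continuous a).comp continuous_σ)⟩,
    f.toCc.hasCompactSupport.mul_right⟩ : C_c(Λ.BoundaryGE n, ℂ))

lemma PreX.smul_apply (a : C₀(Λ.Boundary, ℂ)) (f : Λ.PreX n) (x : Λ.BoundaryGE n) :
    (a • f) x = f x * a (σ n x) := rfl

variable [Λ.FinitelyAligned]

/-- The inner product `⟨f, g⟩_n(x) = ∑_{σ_n(y) = x} conj(f(y)) g(y)`. -/
noncomputable instance : Inner C₀(Λ.Boundary, ℂ) (Λ.PreX n) where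
  inner f g := transfer (star f.toCc * g.toCc)

lemma PreX.inner_apply (f g : Λ.PreX n) (x : Λ.Boundary) :
    (inner C₀(Λ.Boundary, ℂ) f g) x =
      ∑' y : {y : Λ.BoundaryGE n // σ n y = x}, conj (f y.1) * g y.1 := rfl

lemma PreX.inner_self_apply (f : Λ.PreX n) (x : Λ.Boundary) :
    (inner C₀(Λ.Boundary, ℂ) f f) x =
      ((∑' y : {y : Λ.BoundaryGE n // σ n y = x}, ‖f y.1‖ ^ 2 : ℝ) : ℂ) := by
  rw [PreX.inner_apply, Complex.ofReal_tsum]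
  refine tsum_congr fun y => ?_
  rw [Complex.conj_mul']
  push_cast; rfl

lemma PreX.summable_sq (f : Λ.PreX n) (x : Λ.Boundary) :
    Summable fun y : {y : Λ.BoundaryGE n // σ n y = x} => ‖f y.1‖ ^ 2 := by
  refine summable_of_hasFiniteSupport ((finite_support_fibre f.toCc x).subset ?_)
  intro y hy h0
  have h1 : f y.1 = 0 := h0
  exact hy (by simp [h1])

/-- The norm `‖f‖_n = ‖⟨f, f⟩_n‖^{1/2}`. -/
noncomputable instance : Norm (Λ.PreX n) where
  norm f := √‖(inner C₀(Λ.Boundary, ℂ) f f)‖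

open scoped ComplexOrder in
noncomputable instance : CStarModule C₀(Λ.Boundary, ℂ) (Λ.PreX n) where
  inner_add_right {f g h} := by
    change transfer (star f.toCc * (g.toCc + h.toCc)) = _
    rw [mul_add]
    exact transfer_add _ _
  inner_self_nonneg {f} := fun x => by
    change (0 : ℂ) ≤ (inner C₀(Λ.Boundary, ℂ) f f) x
    rw [PreX.inner_self_apply]
    exact Complex.zero_le_real.2 (tsum_nonneg fun y => by positivity)
  inner_self {f} := by
    constructor
    · intro h
      ext y
      have h1 := PreX.inner_self_apply f (σ n y)
      rw [h] at h1
      have h2 : (∑' z : {z : Λ.BoundaryGE n // σ n z = σ n y}, ‖f z.1‖ ^ 2 : ℝ) = 0 := by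
        exact Complex.ofReal_eq_zero.1 h1.symm
      have h3 := (PreX.summable_sq f (σ n y)).hasSum
      rw [h2, hasSum_zero_iff_of_nonneg (fun z => by positivity)] at h3
      have h4 := congrFun h3 ⟨y, rfl⟩
      have h5 : ‖f y‖ ^ 2 = 0 := h4
      exact norm_eq_zero.1 (pow_eq_zero_iff two_ne_zero |>.1 h5)
    · rintro rfl
      ext x
      rw [PreX.inner_self_apply]
      have : ∀ y, (0 : Λ.PreX n) y = 0 := fun _ => rfl
      simp [this]
  inner_op_smul_right {a f g} := by
    ext x
    rw [PreX.inner_apply]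
    change _ = a x * (inner C₀(Λ.Boundary, ℂ) f g) x
    rw [PreX.inner_apply, ← tsum_mul_left]
    refine tsum_congr fun y => ?_
    rw [PreX.smul_apply, y.2]
    ring
  inner_smul_right_complex {c f g} := by
    change transfer (star f.toCc * (c • g.toCc)) = _
    rw [mul_smul_comm]
    exact transfer_smul _ _
  star_inner f g := by
    change star (transfer (star f.toCc * g.toCc)) = transfer (star g.toCc * f.toCc)
    rw [← transfer_star]
    congr 1
    ext y
    change conj (conj (f y) * g y) = conj (g y) * f y
    rw [map_mul, Complex.conj_conj, mul_comm]
  norm_eq_sqrt_norm_inner_self f := rfl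

noncomputable instance : NormedAddCommGroup (Λ.PreX n) :=
  CStarModule.normedAddCommGroup C₀(Λ.Boundary, ℂ)

noncomputable instance : NormedSpace ℂ (Λ.PreX n) :=
  NormedSpace.ofCore (CStarModule.normedSpaceCore C₀(Λ.Boundary, ℂ))

instance : UniformContinuousConstSMul C₀(Λ.Boundary, ℂ) (Λ.PreX n) :=
  HilbertModule.uniformContinuousConstSMul

variable (Λ n)

/-- The Hilbert `C₀(∂Λ)`-module `X_n`: the completion of `C_c(∂Λ^{≥n})`. It carries Mathlib's
structure `CStarModule C₀(∂Λ) X_n` of a Hilbert module. -/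
abbrev X : Type _ := UniformSpace.Completion (Λ.PreX n)

end Modules

section Multiplication

variable {Λ : KGraph k} {l m n : Fin k → ℕ}

/-- The inclusion `∂Λ^{≥n} ⊆ ∂Λ^{≥l}` for `n = l + m`. -/
def incl (h : l + m = n) (x : Λ.BoundaryGE n) : Λ.BoundaryGE l :=
  ⟨x.1, (up_le_up.2 (h ▸ le_self_add)).trans x.2⟩

/-- The shift `σ_l`, as a map `∂Λ^{≥n} → ∂Λ^{≥m}` for `n = l + m`. -/
def shiftGE (h : l + m = n) (x : Λ.BoundaryGE n) : Λ.BoundaryGE m :=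
  ⟨σ l (incl h x), up_le_sub (m := x.1.1.deg) (by rw [h]; exact x.2)⟩

lemma continuous_incl (h : l + m = n) : Continuous (incl h : Λ.BoundaryGE n → Λ.BoundaryGE l) :=
  Continuous.subtype_mk continuous_val _

lemma continuous_shiftGE (h : l + m = n) :
    Continuous (shiftGE h : Λ.BoundaryGE n → Λ.BoundaryGE m) :=
  Continuous.subtype_mk (continuous_σ.comp (continuous_incl h)) _

lemma isInducing_incl (h : l + m = n) :
    IsInducing (incl h : Λ.BoundaryGE n → Λ.BoundaryGE l) :=
  IsInducing.of_comp (continuous_incl h) continuous_val IsInducing.subtypeVal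

lemma exists_incl_eq (h : l + m = n) (y : Λ.BoundaryGE l) (z : Λ.BoundaryGE m)
    (hyz : σ l y = z.1) : ∃ x : Λ.BoundaryGE n, incl h x = y ∧ shiftGE h x = z := by
  have hz : up m ≤ (σ l y).1.deg := by rw [hyz]; exact z.2
  have hd : up n ≤ y.1.1.deg := by rw [← h]; exact up_add_le_of_le_sub y.2 hz
  exact ⟨⟨y.1, hd⟩, rfl, Subtype.ext hyz⟩

lemma σ_shiftGE (h : l + m = n) (x : Λ.BoundaryGE n) : σ m (shiftGE h x) = σ n x := by
  refine Subtype.ext (GraphMorphism.ext_seg ?_ fun p q hpq hx hy => ?_)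
  · subst h
    change x.1.1.deg - up l - up m = x.1.1.deg - up (l + m)
    exact (tsub_add_eq_tsub_tsub _ _ _).symm.trans (congrArg (x.1.1.deg - ·) (up_add l m).symm)
  · exact x.1.1.seg_congr (by subst h; exact (add_assoc _ _ _).symm)
      (by subst h; exact (add_assoc _ _ _).symm) _ _

/-- The product `(fg)(x) = f(x) g(σ_l(x))` of `f ∈ C_c(∂Λ^{≥l})` and `g ∈ C_c(∂Λ^{≥m})`, an
element of `C_c(∂Λ^{≥n})`, `n = l + m`. -/
def PreX.mul (h : l + m = n) (f : Λ.PreX l) (g : Λ.PreX m) : Λ.PreX n :=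
  (⟨⟨fun x => f (incl h x) * g (shiftGE h x),
    ((map_continuous f.toCc).comp (continuous_incl h)).mul
      ((map_continuous g.toCc).comp (continuous_shiftGE h))⟩, by
    have hf : IsCompact (tsupport f.toCc) := f.toCc.hasCompactSupport
    have hg : IsCompact (tsupport g.toCc) := g.toCc.hasCompactSupport
    refine HasCompactSupport.intro
      (K := {x | incl h x ∈ tsupport f.toCc ∧ shiftGE h x ∈ tsupport g.toCc}) ?_ ?_
    · rw [(isInducing_incl h).isCompact_iff]
      have : incl h '' {x | incl h x ∈ tsupport f.toCc ∧ shiftGE h x ∈ tsupport g.toCc} =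
          tsupport f.toCc ∩ σ l ⁻¹' ((fun z : Λ.BoundaryGE m => z.1) '' tsupport g.toCc) := by
        ext y
        constructor
        · rintro ⟨x, ⟨h1, h2⟩, rfl⟩
          exact ⟨h1, shiftGE h x, h2, rfl⟩
        · rintro ⟨h1, z, h2, h3⟩
          obtain ⟨x, rfl, rfl⟩ := exists_incl_eq h y z h3.symm
          exact ⟨x, ⟨h1, h2⟩, rfl⟩
      rw [this]
      exact hf.inter_right ((hg.image continuous_val).isClosed.preimage continuous_σ)
    · intro x hx
      by_contra hne
      exact hx ⟨subset_tsupport _ (left_ne_zero_of_mul hne),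
        subset_tsupport _ (right_ne_zero_of_mul hne)⟩⟩ : C_c(Λ.BoundaryGE n, ℂ))

lemma PreX.mul_apply (h : l + m = n) (f : Λ.PreX l) (g : Λ.PreX m) (x : Λ.BoundaryGE n) :
    PreX.mul h f g x = f (incl h x) * g (shiftGE h x) := rfl

variable [Λ.FinitelyAligned]

lemma PreX.norm_sq_apply_le (f : Λ.PreX n) (x : Λ.Boundary) :
    ∑' y : {y : Λ.BoundaryGE n // σ n y = x}, ‖f y.1‖ ^ 2 ≤ ‖f‖ ^ 2 := by
  rw [CStarModule.norm_sq_eq C₀(Λ.Boundary, ℂ)]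
  have h1 := (inner C₀(Λ.Boundary, ℂ) f f).toBCF.norm_coe_le_norm x
  have h2 : ((inner C₀(Λ.Boundary, ℂ) f f).toBCF x) = (inner C₀(Λ.Boundary, ℂ) f f) x := rfl
  rw [h2, PreX.inner_self_apply, Complex.norm_real, Real.norm_of_nonneg
    (tsum_nonneg fun y => by positivity)] at h1
  exact h1

lemma PreX.norm_le {f : Λ.PreX n} {C : ℝ} (hC : 0 ≤ C)
    (h : ∀ x, ∑' y : {y : Λ.BoundaryGE n // σ n y = x}, ‖f y.1‖ ^ 2 ≤ C ^ 2) : ‖f‖ ≤ C := by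
  refine le_of_sq_le_sq ?_ hC
  rw [CStarModule.norm_sq_eq C₀(Λ.Boundary, ℂ)]
  refine (BoundedContinuousFunction.norm_le (f := (inner C₀(Λ.Boundary, ℂ) f f).toBCF)
    (by positivity)).2 fun x => ?_
  have h2 : ((inner C₀(Λ.Boundary, ℂ) f f).toBCF x) = (inner C₀(Λ.Boundary, ℂ) f f) x := rfl
  rw [h2, PreX.inner_self_apply, Complex.norm_real, Real.norm_of_nonneg
    (tsum_nonneg fun y => by positivity)]
  exact h x

/-- The fibres of `σ_n = σ_m ∘ σ_l`. -/
def fibreEquiv (h : l + m = n) (x : Λ.Boundary) :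
    (Σ z : {z : Λ.BoundaryGE m // σ m z = x}, {y : Λ.BoundaryGE l // σ l y = z.1.1}) ≃
      {y : Λ.BoundaryGE n // σ n y = x} where
  toFun := fun p => ⟨⟨p.2.1.1, by
    have hz : up m ≤ (σ l p.2.1).1.deg := by rw [p.2.2]; exact p.1.1.2
    rw [← h]; exact up_add_le_of_le_sub p.2.1.2 hz⟩, by
    refine (σ_shiftGE h _).symm.trans (Eq.trans ?_ p.1.2)
    exact congrArg (σ m) (Subtype.ext p.2.2)⟩
  invFun := fun y => ⟨⟨shiftGE h y.1, (σ_shiftGE h y.1).trans y.2⟩, ⟨incl h y.1, rfl⟩⟩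
  left_inv := by
    rintro ⟨⟨⟨z, hz⟩, hz'⟩, ⟨y, hy⟩⟩
    dsimp only at hy
    subst hy
    rfl
  right_inv := fun y => rfl

lemma tsum_fibre_mul (h : l + m = n) (x : Λ.Boundary) (u : Λ.BoundaryGE l → ℝ)
    (v : Λ.BoundaryGE m → ℝ)
    (hs : Summable fun y : {y : Λ.BoundaryGE n // σ n y = x} =>
      u (incl h y.1) * v (shiftGE h y.1))
    (hu : ∀ z : Λ.Boundary, Summable fun y : {y : Λ.BoundaryGE l // σ l y = z} => u y.1) :
    ∑' y : {y : Λ.BoundaryGE n // σ n y = x}, u (incl h y.1) * v (shiftGE h y.1) =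
      ∑' z : {z : Λ.BoundaryGE m // σ m z = x},
        (∑' y : {y : Λ.BoundaryGE l // σ l y = z.1.1}, u y.1) * v z.1 := by
  have key : ∀ p, u (incl h (fibreEquiv h x p).1) * v (shiftGE h (fibreEquiv h x p).1) =
      u p.2.1 * v p.1.1 := by
    rintro ⟨⟨⟨z, hz⟩, hz'⟩, ⟨y, hy⟩⟩
    dsimp only at hy
    subst hy
    rfl
  have hs' : Summable fun p : (Σ z : {z : Λ.BoundaryGE m // σ m z = x},
      {y : Λ.BoundaryGE l // σ l y = z.1.1}) => u p.2.1 * v p.1.1 :=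
    ((fibreEquiv h x).summable_iff.2 hs).congr key
  have h1 : ∑' y : {y : Λ.BoundaryGE n // σ n y = x}, u (incl h y.1) * v (shiftGE h y.1) =
      ∑' p : (Σ z : {z : Λ.BoundaryGE m // σ m z = x},
        {y : Λ.BoundaryGE l // σ l y = z.1.1}), u p.2.1 * v p.1.1 :=
    ((fibreEquiv h x).tsum_eq _).symm.trans (tsum_congr key)
  have h2 := hs'.tsum_sigma' fun z => (hu z.1.1).mul_right (v z.1)
  refine h1.trans (h2.trans (tsum_congr fun z => ?_))
  exact tsum_mul_right (f := fun y : {y : Λ.BoundaryGE l // σ l y = z.1.1} => u y.1) (a := v z.1)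

lemma PreX.norm_mul_le (h : l + m = n) (f : Λ.PreX l) (g : Λ.PreX m) :
    ‖PreX.mul h f g‖ ≤ ‖f‖ * ‖g‖ := by
  refine PreX.norm_le (by positivity) fun x => ?_
  have e : ∀ y : Λ.BoundaryGE n,
      ‖PreX.mul h f g y‖ ^ 2 = ‖f (incl h y)‖ ^ 2 * ‖g (shiftGE h y)‖ ^ 2 := fun y => by
    rw [PreX.mul_apply, norm_mul, mul_pow]
  have hs := PreX.summable_sq (PreX.mul h f g) x
  simp only [e] at hs ⊢
  rw [tsum_fibre_mul h x (fun y => ‖f y‖ ^ 2) (fun y => ‖g y‖ ^ 2) hs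
    fun z => PreX.summable_sq f z]
  have hb : ∀ z : {z : Λ.BoundaryGE m // σ m z = x},
      (∑' y : {y : Λ.BoundaryGE l // σ l y = z.1.1}, ‖f y.1‖ ^ 2) * ‖g z.1‖ ^ 2 ≤
        ‖f‖ ^ 2 * ‖g z.1‖ ^ 2 := fun z =>
    mul_le_mul_of_nonneg_right (PreX.norm_sq_apply_le f z.1.1) (by positivity)
  have hsum := (PreX.summable_sq g x).mul_left (‖f‖ ^ 2)
  refine (Summable.tsum_le_tsum hb
    (hsum.of_nonneg_of_le (fun z => mul_nonneg (tsum_nonneg fun y => by positivity)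
      (by positivity)) hb) hsum).trans ?_
  rw [tsum_mul_left, mul_pow]
  exact mul_le_mul_of_nonneg_left (PreX.norm_sq_apply_le g x) (by positivity)

/-- The multiplication on compactly supported functions as a bilinear map. -/
noncomputable def PreX.mulₗ (h : l + m = n) : Λ.PreX l →ₗ[ℂ] Λ.PreX m →ₗ[ℂ] Λ.PreX n :=
  LinearMap.mk₂ ℂ (PreX.mul h)
    (fun _ _ _ => PreX.ext fun _ => add_mul _ _ _)
    (fun _ _ _ => PreX.ext fun _ => mul_assoc _ _ _)
    (fun _ _ _ => PreX.ext fun _ => mul_add _ _ _)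
    (fun _ _ _ => PreX.ext fun _ => mul_left_comm _ _ _)

lemma PreX.continuous_mul (h : l + m = n) :
    Continuous fun p : Λ.PreX l × Λ.PreX m => PreX.mul h p.1 p.2 :=
  (LinearMap.mkContinuous₂ (PreX.mulₗ (Λ := Λ) h) 1 fun f g => by
    rw [one_mul]; exact PreX.norm_mul_le h f g).continuous₂

/-- The multiplication `X_l × X_m → X_n`, `n = l + m`, of the boundary-path product system: the
continuous extension of `(f, g) ↦ fg`, `(fg)(x) = f(x) g(σ_l(x))`. -/
noncomputable def X.mul (h : l + m = n) (x : Λ.X l) (y : Λ.X m) : Λ.X n :=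
  (UniformSpace.Completion.isDenseInducing_coe.prodMap
    UniformSpace.Completion.isDenseInducing_coe).extend
    (fun p : Λ.PreX l × Λ.PreX m => ((PreX.mul h p.1 p.2 : Λ.PreX n) : Λ.X n)) (x, y)

/-- The multiplication extends the one of compactly supported functions. -/
lemma X.mul_coe (h : l + m = n) (f : Λ.PreX l) (g : Λ.PreX m) :
    X.mul h (f : Λ.X l) (g : Λ.X m) = ((PreX.mul h f g : Λ.PreX n) : Λ.X n) :=
  (UniformSpace.Completion.isDenseInducing_coe.prodMap
    UniformSpace.Completion.isDenseInducing_coe).extend_eq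
    ((UniformSpace.Completion.continuous_coe _).comp (PreX.continuous_mul h)) (f, g)

/-- The multiplication is jointly continuous. -/
lemma X.continuous_mul (h : l + m = n) :
    Continuous fun p : Λ.X l × Λ.X m => X.mul h p.1 p.2 := by
  let φ : Λ.PreX l →+ Λ.PreX m →+ Λ.X n :=
    { toFun := fun f => (UniformSpace.Completion.toCompl (α := Λ.PreX n)).comp
        (PreX.mulₗ h f).toAddMonoidHom
      map_zero' := by
        ext g
        change ((PreX.mulₗ h 0 g : Λ.PreX n) : Λ.X n) = 0
        rw [map_zero]; rfl
      map_add' := fun f f' => by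
        ext g
        change ((PreX.mulₗ h (f + f') g : Λ.PreX n) : Λ.X n) = _
        rw [map_add]; exact UniformSpace.Completion.coe_add _ _ }
  have hφ : Continuous fun p : Λ.PreX l × Λ.PreX m => φ p.1 p.2 :=
    (UniformSpace.Completion.continuous_coe _).comp (PreX.continuous_mul h)
  exact (UniformSpace.Completion.isDenseInducing_toCompl (Λ.PreX l)).extend_Z_bilin
    (UniformSpace.Completion.isDenseInducing_toCompl (Λ.PreX m)) hφ

end Multiplication

section CompactlyAligned

variable (Λ : KGraph k) [Λ.FinitelyAligned]

/-- The bounded operators on the Hilbert module `X_n`. -/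
abbrev Op (n : Fin k → ℕ) : Type _ := Λ.X n →L[ℂ] Λ.X n

/-- The compact operators `𝒦(X_n)`. -/
noncomputable abbrev compacts (n : Fin k → ℕ) : Submodule ℂ (Λ.Op n) :=
  HilbertModule.compactOperators C₀(Λ.Boundary, ℂ) (Λ.X n)

/-- For `m ≤ q`, `S' = ι_m^q(S)`: the adjointable operator `S'` on `X_q` satisfies
`S'(xy) = (Sx)y` for all `x ∈ X_m` and `y ∈ X_{q-m}`. -/
def IsIota {m q : Fin k → ℕ} (hmq : m ≤ q) (S : Λ.Op m) (S' : Λ.Op q) : Prop :=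
  HilbertModule.IsAdjointable C₀(Λ.Boundary, ℂ) S' ∧
    ∀ (x : Λ.X m) (y : Λ.X (q - m)),
      S' (X.mul (add_tsub_cancel_of_le hmq) x y) = X.mul (add_tsub_cancel_of_le hmq) (S x) y

/-- The product system `X` is compactly aligned: for all `S ∈ 𝒦(X_m)` and `T ∈ 𝒦(X_n)` the
operators `ι_m^{m∨n}(S)` and `ι_n^{m∨n}(T)` exist, are unique, and have compact product. -/
def CompactlyAligned : Prop :=
  ∀ (m n : Fin k → ℕ) (S : Λ.Op m) (T : Λ.Op n), S ∈ Λ.compacts m → T ∈ Λ.compacts n →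
    (∃! S' : Λ.Op (m ⊔ n), Λ.IsIota (q := m ⊔ n) le_sup_left S S') ∧
    (∃! T' : Λ.Op (m ⊔ n), Λ.IsIota (q := m ⊔ n) le_sup_right T T') ∧
    ∀ S' T' : Λ.Op (m ⊔ n), Λ.IsIota (q := m ⊔ n) le_sup_left S S' →
      Λ.IsIota (q := m ⊔ n) le_sup_right T T' →
      S' ∘L T' ∈ Λ.compacts (m ⊔ n)

end CompactlyAligned

end KGraph

/-! ### The topology of the spaces ∂Λ^{≥n} and extension by zero -/

namespace KGraph

variable {k : ℕ} {Λ : KGraph k} {l m n : Fin k → ℕ}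

/-! For f ∈ C_c(∂Λ^{≥l}) and n = l + m let T_f : X_m → X_n be y ↦ fy. Its adjoint T_f^* sends z ∈
C_c(∂Λ^{≥n}) to w ↦ ∑_{σ_l(y) = w} conj(f(y)) z(y). On a product this gives T_g^*(xy) = ⟨g, x⟩y,
hence T_f T_g^*(xy) = (Θ_{f,g} x)y: the operator T_f T_g^* is ι(Θ_{f,g})
(`X.creation_annihilation_mul`).

To reach all of 𝒦(X_l) one needs ‖∑ T_{f_i} T_{g_i}^*‖ ≤ ‖∑ Θ_{f_i,g_i}‖
(`norm_snd_le_of_mem_iotaGraph`). This is a spectral-radius argument: the C*-inequality bounds a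
large power of the left side by the same power of the right side up to a fixed constant, and taking
roots removes the constant. The closure of the graph `iotaGraph` is then the graph of a contraction
whose domain is closed and contains every rank-one operator. Uniqueness of ι holds because every
function in C_c(∂Λ^{≥n}) is a finite sum of products (`PreX.exists_sum_mul`): compact support leaves
only finitely many initial segments of degree n, and σ_n is injective on the paths with a given one.

For compactness let p = m ∨ n. The operator T_g^* T_u multiplies y ∘ σ_n by conj(g)u and sums over
the fibres of σ_m. Since ∂Λ^{≥m} ∩ ∂Λ^{≥n} = ∂Λ^{≥p} and ∂Λ is Hausdorff, conj(g)u lies in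
C_c(∂Λ^{≥p}). Cut into finitely many pieces by initial segment, it yields finitely many operators of
rank one (`PreX.exists_annih_mul_eq`). So T_f T_g^* T_u T_v^* has finite rank, and continuity gives
the general case (`comp_mem_compacts`).

Finite alignment enters through the maps x ↦ λx: they preserve boundary paths and are continuous, so
that fibre sums of compactly supported functions lie in C₀(∂Λ). -/

lemma isOpen_boundaryGE (n : Fin k → ℕ) : IsOpen {x : Λ.Boundary | up n ≤ x.1.deg} := by
  rw [isOpen_iff_forall_mem_open]
  intro x hx
  refine ⟨D (head (⟨x, hx⟩ : Λ.BoundaryGE n)), fun y hy => ?_, isOpen_D _, mem_D_head _⟩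
  have h := (mem_D.1 hy).1
  rwa [d_head] at h

lemma isOpenEmbedding_incl (h : l + m = n) :
    IsOpenEmbedding (incl h : Λ.BoundaryGE n → Λ.BoundaryGE l) := by
  refine ⟨⟨isInducing_incl h, fun x y hxy => Subtype.ext (congrArg (fun z => z.1) hxy)⟩, ?_⟩
  have : range (incl h : Λ.BoundaryGE n → Λ.BoundaryGE l) =
      (fun x : Λ.BoundaryGE l => x.1) ⁻¹' {x : Λ.Boundary | up n ≤ x.1.deg} := by
    ext y
    constructor
    · rintro ⟨x, rfl⟩
      exact x.2
    · intro hy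
      exact ⟨⟨y.1, hy⟩, rfl⟩
  rw [this]
  exact (isOpen_boundaryGE n).preimage continuous_val

/-- Near a point of the image the extension is f in an open chart. A point off the image lies in the
complement of e(supp f), which is open because e(supp f) is compact in a Hausdorff space, and there
the extension is zero. -/
lemma continuous_extend_zero {X Y : Type*} [TopologicalSpace X] [TopologicalSpace Y] [T2Space Y]
    {e : X → Y} (he : IsOpenEmbedding e) {f : X → ℂ} (hf : Continuous f)
    (hc : HasCompactSupport f) : Continuous (Function.extend e f 0) := by
  refine continuous_iff_continuousAt.2 fun y => ?_
  by_cases hy : y ∈ range e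
  · obtain ⟨x, rfl⟩ := hy
    rw [← he.continuousAt_iff, Function.extend_comp he.injective]
    exact hf.continuousAt
  · have hcl : IsClosed (e '' tsupport f) := (IsCompact.image hc he.continuous).isClosed
    have hy' : y ∈ (e '' tsupport f)ᶜ := fun ⟨x, _, hx⟩ => hy ⟨x, hx⟩
    refine (continuousAt_const (y := (0 : ℂ))).congr ?_
    filter_upwards [hcl.isOpen_compl.mem_nhds hy'] with z hz
    by_cases hze : ∃ x, e x = z
    · obtain ⟨x, rfl⟩ := hze
      rw [he.injective.extend_apply]
      by_contra hne
      exact hz ⟨x, subset_tsupport f (Ne.symm hne), rfl⟩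
    · rw [Function.extend_apply' _ _ _ hze]; rfl

/-- A path is determined by its initial segment of degree n and its shift by n, and σ_n = σ_m ∘ σ_l.
Because of this, fibre sums over paths with a common initial segment have at most one term. -/
lemma shiftGE_injOn_head (h : l + m = n) {x y : Λ.BoundaryGE n} (hh : head x = head y)
    (hs : shiftGE h x = shiftGE h y) : x = y :=
  ext_σ hh (by rw [← σ_shiftGE h, ← σ_shiftGE h, hs])

/-! ### Cutting and factoring compactly supported functions -/

namespace PreX

/-- An element of `C_c(∂Λ^{≥n})` given by a continuous function vanishing off a compact set. -/
def ofCompact (f : Λ.BoundaryGE n → ℂ) (hf : Continuous f) (K : Set (Λ.BoundaryGE n))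
    (hK : IsCompact K) (h : ∀ x, x ∉ K → f x = 0) : Λ.PreX n :=
  (⟨⟨f, hf⟩, HasCompactSupport.intro hK h⟩ : C_c(Λ.BoundaryGE n, ℂ))

lemma ofCompact_apply (f : Λ.BoundaryGE n → ℂ) (hf : Continuous f) (K : Set (Λ.BoundaryGE n))
    (hK : IsCompact K) (h : ∀ x, x ∉ K → f x = 0) (x : Λ.BoundaryGE n) :
    ofCompact f hf K hK h x = f x := rfl

protected lemma continuous (f : Λ.PreX n) : Continuous (fun x => f x) := map_continuous f.toCc

lemma isCompact_tsupport (f : Λ.PreX n) : IsCompact (tsupport fun x => f x) :=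
  f.toCc.hasCompactSupport

lemma mem_tsupport {f : Λ.PreX n} {x : Λ.BoundaryGE n} (h : f x ≠ 0) :
    x ∈ tsupport fun x => f x := subset_tsupport _ h

lemma zero_apply (x : Λ.BoundaryGE n) : (0 : Λ.PreX n) x = 0 := rfl

lemma add_apply (f g : Λ.PreX n) (x : Λ.BoundaryGE n) : (f + g) x = f x + g x := rfl

lemma sum_apply {ι : Type*} (s : Finset ι) (f : ι → Λ.PreX n) (x : Λ.BoundaryGE n) :
    (∑ i ∈ s, f i) x = ∑ i ∈ s, f i x := by
  classical
  induction s using Finset.induction_on with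
  | empty => simp [zero_apply]
  | insert a s ha ih => rw [Finset.sum_insert ha, Finset.sum_insert ha, add_apply, ih]

/-- The pointwise product of a continuous function with an element of `C_c(∂Λ^{≥n})`. -/
noncomputable def cmul (u : C(Λ.BoundaryGE n, ℂ)) (f : Λ.PreX n) : Λ.PreX n :=
  ofCompact (fun x => u x * f x) (u.continuous.mul f.continuous) _ f.isCompact_tsupport
    fun x hx => by
      by_contra hne
      exact hx (mem_tsupport (right_ne_zero_of_mul hne))

lemma cmul_apply (u : C(Λ.BoundaryGE n, ℂ)) (f : Λ.PreX n) (x : Λ.BoundaryGE n) :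
    cmul u f x = u x * f x := rfl

/-- The complex conjugate. -/
noncomputable def conjugate (f : Λ.PreX n) : Λ.PreX n :=
  ofCompact (fun x => conj (f x)) (Complex.continuous_conj.comp f.continuous) _
    f.isCompact_tsupport fun x hx => by
      by_contra hne
      refine hx (mem_tsupport fun h0 => hne ?_)
      rw [h0, map_zero]

open Classical in
/-- The restriction of `f` to the clopen set of all paths with initial segment `a`. -/
noncomputable def restrictHead (a : Λ.Path) (f : Λ.PreX n) : Λ.PreX n :=
  cmul ⟨fun x => if head x = a then 1 else 0,
    continuous_const.if (fun x hx => by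
      have : frontier {x : Λ.BoundaryGE n | head x = a} = ∅ := (isClopen_head a).frontier_eq
      rw [this] at hx
      exact hx.elim) continuous_const⟩ f

open Classical in
lemma restrictHead_apply (a : Λ.Path) (f : Λ.PreX n) (x : Λ.BoundaryGE n) :
    restrictHead a f x = if head x = a then f x else 0 := by
  change (if head x = a then (1 : ℂ) else 0) * f x = _
  split_ifs <;> simp

/-- `f` vanishes off the paths with initial segment `a`. -/
def SupportedOn (a : Λ.Path) (f : Λ.PreX n) : Prop := ∀ x, f x ≠ 0 → head x = a

lemma supportedOn_restrictHead (a : Λ.Path) (f : Λ.PreX n) :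
    SupportedOn a (restrictHead a f) := by
  intro x hx
  by_contra h
  exact hx (by rw [restrictHead_apply, if_neg h])

/-- The sets of paths with a given initial segment of degree n form a partition into open sets, and
a compact support meets only finitely many of them. -/
lemma exists_sum_restrictHead (f : Λ.PreX n) :
    ∃ I : Finset Λ.Path, f = ∑ a ∈ I, restrictHead a f := by
  obtain ⟨I, hI⟩ := exists_finset_head f.toCc
  refine ⟨I, PreX.ext fun x => ?_⟩
  rw [sum_apply]
  have h0 : restrictHead (head x) f x = f x := by rw [restrictHead_apply, if_pos rfl]
  rw [Finset.sum_eq_single (head x), h0]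
  · intro a _ ha
    rw [restrictHead_apply, if_neg ha.symm]
  · intro h
    rw [h0]
    by_contra hne
    exact h (hI x hne)

/-- Only z = 0 needs care: the value there is 0/0 = 0, and the modulus of the function is √|z|,
which tends to 0. -/
lemma continuous_div_sqrt_norm : Continuous fun z : ℂ => z / (√‖z‖ : ℝ) := by
  refine continuous_iff_continuousAt.2 fun z => ?_
  by_cases hz : z = 0
  · subst hz
    have h0 : ∀ z : ℂ, ‖z / ((√‖z‖ : ℝ) : ℂ)‖ = √‖z‖ := fun z => by
      rw [norm_div, Complex.norm_real, Real.norm_of_nonneg (Real.sqrt_nonneg _), Real.div_sqrt]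
    rw [ContinuousAt, zero_div, tendsto_zero_iff_norm_tendsto_zero]
    simp only [h0]
    have : Continuous fun z : ℂ => √‖z‖ := by fun_prop
    simpa using this.tendsto 0
  · refine continuousAt_id.div ?_ ?_
    · exact (Complex.continuous_ofReal.comp (Real.continuous_sqrt.comp continuous_norm)).continuousAt
    · exact Complex.ofReal_ne_zero.2 (Real.sqrt_ne_zero'.2 (norm_pos_iff.2 hz))

/-- The factors are p = √|f| and q = f/√|f|. Since both vanish wherever f does, they stay supported
on the same initial segment as f. -/
lemma exists_eq_mul (f : Λ.PreX n) : ∃ p q : Λ.PreX n, (∀ x, f x = p x * q x) ∧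
    ∀ x, f x = 0 → p x = 0 ∧ q x = 0 := by
  refine ⟨ofCompact (fun x => ((√‖f x‖ : ℝ) : ℂ)) ?_ _ f.isCompact_tsupport ?_,
    ofCompact (fun x => f x / ((√‖f x‖ : ℝ) : ℂ)) (continuous_div_sqrt_norm.comp f.continuous) _
      f.isCompact_tsupport ?_, fun x => ?_, fun x hx => ?_⟩
  · exact Complex.continuous_ofReal.comp (Real.continuous_sqrt.comp f.continuous.norm)
  · intro x hx
    have : f x = 0 := by_contra fun h => hx (mem_tsupport h)
    simp [this]
  · intro x hx
    have : f x = 0 := by_contra fun h => hx (mem_tsupport h)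
    simp [this]
  · rw [ofCompact_apply, ofCompact_apply]
    by_cases hx : f x = 0
    · simp [hx]
    · rw [mul_div_cancel₀]
      exact Complex.ofReal_ne_zero.2 (Real.sqrt_ne_zero'.2 (norm_pos_iff.2 hx))
  · simp [ofCompact_apply, hx]

/-- The extension by zero `C_c(∂Λ^{≥n}) → C_c(∂Λ^{≥l})`, for `n = l + m`. -/
noncomputable def extZero (h : l + m = n) (f : Λ.PreX n) : Λ.PreX l :=
  ofCompact (Function.extend (incl h) (fun x => f x) 0)
    (continuous_extend_zero (isOpenEmbedding_incl h) f.continuous f.isCompact_tsupport)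
    (incl h '' tsupport fun x => f x) (f.isCompact_tsupport.image (continuous_incl h)) (by
      intro y hy
      by_cases hye : ∃ x, incl h x = y
      · obtain ⟨x, rfl⟩ := hye
        rw [(isOpenEmbedding_incl h).injective.extend_apply]
        by_contra hne
        exact hy ⟨x, mem_tsupport hne, rfl⟩
      · rw [Function.extend_apply' _ _ _ hye]; rfl)

lemma extZero_incl (h : l + m = n) (f : Λ.PreX n) (x : Λ.BoundaryGE n) :
    extZero h f (incl h x) = f x := (isOpenEmbedding_incl h).injective.extend_apply _ _ _

lemma exists_of_extZero_ne_zero (h : l + m = n) {f : Λ.PreX n} {y : Λ.BoundaryGE l}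
    (hy : extZero h f y ≠ 0) : ∃ x, incl h x = y ∧ f x ≠ 0 := by
  by_cases hye : ∃ x, incl h x = y
  · obtain ⟨x, rfl⟩ := hye
    rw [extZero_incl] at hy
    exact ⟨x, rfl, hy⟩
  · exact (hy (Function.extend_apply' _ _ _ hye)).elim

/-- A relation between functions on `∂Λ^{≥n}` carries over to their extensions by zero on a fibre of
`σ_l` over a point of `∂Λ^{≥m}`, because such a fibre lies in `∂Λ^{≥n}`. -/
lemma extZero_congr (h : l + m = n) {f g : Λ.PreX n} {w : Λ.BoundaryGE m} {c : ℂ}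
    {u : Λ.BoundaryGE l → ℂ}
    (hfg : ∀ x : Λ.BoundaryGE n, shiftGE h x = w → f x = c * (u (incl h x) * g x))
    {y : Λ.BoundaryGE l} (hy : σ l y = w.1) :
    extZero h f y = c * (u y * extZero h g y) := by
  obtain ⟨x, rfl, hx⟩ := exists_incl_eq h y w hy
  rw [extZero_incl, extZero_incl, hfg x hx]

/-! ### Summation over the fibres of σ_l -/

variable [Λ.FinitelyAligned]

/-- The sum `w ↦ ∑_{σ_l(y) = w} f(y)`, as an element of `C_c(∂Λ^{≥m})`, for `f ∈ C_c(∂Λ^{≥n})` and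
`n = l + m`. -/
noncomputable def shiftSum (h : l + m = n) (f : Λ.PreX n) : Λ.PreX m :=
  ofCompact (fun w => transfer (extZero h f).toCc w.1)
    ((map_continuous (transfer (extZero h f).toCc)).comp continuous_val)
    (shiftGE h '' tsupport fun x => f x) (f.isCompact_tsupport.image (continuous_shiftGE h)) (by
      intro w hw
      have h0 : ∀ y : {y : Λ.BoundaryGE l // σ l y = w.1}, extZero h f y.1 = 0 := by
        rintro ⟨y, hy⟩
        obtain ⟨x, rfl, rfl⟩ := exists_incl_eq h y w hy
        rw [extZero_incl]
        by_contra hne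
        exact hw ⟨x, mem_tsupport hne, rfl⟩
      exact (tsum_congr h0).trans tsum_zero)

lemma shiftSum_apply (h : l + m = n) (f : Λ.PreX n) (w : Λ.BoundaryGE m) :
    shiftSum h f w = ∑' y : {y : Λ.BoundaryGE l // σ l y = w.1}, extZero h f y.1 := rfl

lemma exists_of_shiftSum_ne_zero (h : l + m = n) {f : Λ.PreX n} {w : Λ.BoundaryGE m}
    (hw : shiftSum h f w ≠ 0) : ∃ x, shiftGE h x = w ∧ f x ≠ 0 := by
  by_contra! hcon
  refine hw ?_
  have h0 : ∀ y : {y : Λ.BoundaryGE l // σ l y = w.1}, extZero h f y.1 = 0 := by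
    rintro ⟨y, hy⟩
    obtain ⟨x, rfl, rfl⟩ := exists_incl_eq h y w hy
    rw [extZero_incl]
    exact hcon x rfl
  exact (tsum_congr h0).trans tsum_zero

/-- By `shiftGE_injOn_head` the path x is the only one in its fibre with initial segment a, so the
sum reduces to the term at x. -/
lemma SupportedOn.shiftSum_shiftGE (h : l + m = n) {f : Λ.PreX n} {a : Λ.Path}
    (hf : SupportedOn a f) {x : Λ.BoundaryGE n} (hx : head x = a) :
    shiftSum h f (shiftGE h x) = f x := by
  rw [shiftSum_apply, tsum_eq_single ⟨incl h x, rfl⟩]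
  · exact extZero_incl h f x
  · rintro ⟨y, hy⟩ hne
    by_contra h0
    obtain ⟨t, rfl, ht⟩ := exists_of_extZero_ne_zero h h0
    refine hne (Subtype.ext ?_)
    have : t = x := shiftGE_injOn_head h ((hf t ht).trans hx.symm) (Subtype.ext hy)
    exact congrArg (incl h) this

lemma SupportedOn.transfer_σ {f : Λ.PreX n} {a : Λ.Path}
    (hf : SupportedOn a f) {x : Λ.BoundaryGE n} (hx : head x = a) :
    transfer f.toCc (σ n x) = f x := by
  rw [transfer_apply, tsum_eq_single ⟨x, rfl⟩]
  · rfl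
  · rintro ⟨y, hy⟩ hne
    by_contra h0
    exact hne (Subtype.ext (ext_σ ((hf y h0).trans hx.symm) hy))

/-- As σ_n = σ_m ∘ σ_l, a sum over a fibre of σ_n can be taken in two stages: over the fibres of
σ_l, then over a fibre of σ_m. -/
lemma transfer_shiftSum (h : l + m = n) (f : Λ.PreX n) :
    transfer (shiftSum h f).toCc = transfer f.toCc := by
  ext x
  have key : ∀ p : (Σ z : {z : Λ.BoundaryGE m // σ m z = x},
      {y : Λ.BoundaryGE l // σ l y = z.1.1}), f (fibreEquiv h x p).1 = extZero h f p.2.1 := by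
    intro p
    exact (extZero_incl h f _).symm
  have hs : Summable fun p : (Σ z : {z : Λ.BoundaryGE m // σ m z = x},
      {y : Λ.BoundaryGE l // σ l y = z.1.1}) => extZero h f p.2.1 :=
    ((fibreEquiv h x).summable_iff.2 (summable_fibre f.toCc x)).congr key
  rw [transfer_apply, transfer_apply]
  symm
  have h1 : (∑' y : {y : Λ.BoundaryGE n // σ n y = x}, f y.1) = ∑' p : (Σ z : {z : Λ.BoundaryGE m //
      σ m z = x}, {y : Λ.BoundaryGE l // σ l y = z.1.1}), extZero h f p.2.1 :=
    ((fibreEquiv h x).tsum_eq _).symm.trans (tsum_congr key)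
  exact h1.trans (hs.tsum_sigma' fun z => summable_fibre (extZero h f).toCc z.1.1)

/-- A function on `∂Λ^{≥m}` can be taken out of the sum defining `shiftSum`. -/
lemma shiftSum_cmul (h : l + m = n) (v : C(Λ.BoundaryGE m, ℂ)) (f : Λ.PreX n) :
    shiftSum h (cmul (v.comp ⟨shiftGE h, continuous_shiftGE h⟩) f) = cmul v (shiftSum h f) := by
  refine PreX.ext fun w => ?_
  rw [cmul_apply, shiftSum_apply, shiftSum_apply, ← tsum_mul_left]
  refine tsum_congr fun y => ?_
  -- On the fibre over w the function v ∘ σ_l is the constant v(w), which comes out of the sum.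
  rw [extZero_congr h (u := fun _ => 1) (c := v w) (g := f) (w := w) ?_ y.2, one_mul]
  rintro x rfl
  rw [one_mul]; rfl

lemma shiftSum_add (h : l + m = n) (f g : Λ.PreX n) :
    shiftSum h (f + g) = shiftSum h f + shiftSum h g := by
  refine PreX.ext fun w => ?_
  have e : extZero h (f + g) = extZero h f + extZero h g := by
    refine PreX.ext fun y => ?_
    by_cases hy : ∃ x, incl h x = y
    · obtain ⟨x, rfl⟩ := hy
      simp only [add_apply, extZero_incl]
    · have h0 : ∀ f : Λ.PreX n, extZero h f y = 0 := fun f =>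
        Function.extend_apply' _ _ _ hy
      rw [add_apply, h0, h0, h0, add_zero]
  change transfer (extZero h (f + g)).toCc w.1 = _
  rw [e]
  exact congrArg (fun a => a w.1) (transfer_add (extZero h f).toCc (extZero h g).toCc)

lemma shiftSum_sum (h : l + m = n) {ι : Type*} (s : Finset ι) (f : ι → Λ.PreX n) :
    shiftSum h (∑ i ∈ s, f i) = ∑ i ∈ s, shiftSum h (f i) :=
  map_sum (AddMonoidHom.mk' (shiftSum (Λ := Λ) h) (shiftSum_add h)) f s

lemma shiftSum_smul (h : l + m = n) (c : ℂ) (f : Λ.PreX n) :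
    shiftSum h (c • f) = c • shiftSum h f := by
  -- The pullback of a constant function is the same constant, so scalars are a case of
  -- `shiftSum_cmul`.
  have := shiftSum_cmul h (ContinuousMap.const _ c) f
  exact this

end PreX

end KGraph

/-! ### Creation and annihilation operators on compactly supported functions -/

namespace KGraph

variable {k : ℕ} {Λ : KGraph k} {l m n : Fin k → ℕ}

namespace PreX

/-- The complex conjugate of a function in `C_c(∂Λ^{≥n})`, as a continuous function. -/
noncomputable def conjMap (f : Λ.PreX n) : C(Λ.BoundaryGE n, ℂ) :=
  ⟨fun x => conj (f x), Complex.continuous_conj.comp f.continuous⟩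

/-- For `p = m ∨ n`, the product of `conj(g)`, `g ∈ C_c(∂Λ^{≥m})`, and `u ∈ C_c(∂Λ^{≥n})` is an
element of `C_c(∂Λ^{≥p})`. -/
lemma exists_conj_mul {p m' n' : Fin k → ℕ} (hm : m + m' = p) (hn : n + n' = p)
    (hp : p = m ⊔ n) (g : Λ.PreX m) (u : Λ.PreX n) :
    ∃ c : Λ.PreX p, ∀ x, c x = conj (g (incl hm x)) * u (incl hn x) := by
  refine ⟨ofCompact (fun x => conj (g (incl hm x)) * u (incl hn x)) ?_
    {x | incl hm x ∈ (tsupport fun x => g x) ∧ incl hn x ∈ (tsupport fun x => u x)} ?_ ?_,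
    fun x => rfl⟩
  · exact (Complex.continuous_conj.comp (g.continuous.comp (continuous_incl hm))).mul
      (u.continuous.comp (continuous_incl hn))
  -- This is where p = m ∨ n is needed: a path lies in ∂Λ^{≥p} exactly when it lies in both ∂Λ^{≥m}
  -- and ∂Λ^{≥n}. Seen inside ∂Λ, the candidate set is therefore the intersection of the two
  -- supports, which is compact since ∂Λ is Hausdorff.
  · have hv : IsInducing (fun x : Λ.BoundaryGE p => x.1) := IsInducing.subtypeVal
    rw [hv.isCompact_iff]
    have e : (fun x : Λ.BoundaryGE p => x.1) '' {x | incl hm x ∈ (tsupport fun x => g x) ∧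
        incl hn x ∈ (tsupport fun x => u x)} =
        (fun x : Λ.BoundaryGE m => x.1) '' (tsupport fun x => g x) ∩
          (fun x : Λ.BoundaryGE n => x.1) '' (tsupport fun x => u x) := by
      ext x
      constructor
      · rintro ⟨x, ⟨h1, h2⟩, rfl⟩
        exact ⟨⟨_, h1, rfl⟩, ⟨_, h2, rfl⟩⟩
      · rintro ⟨⟨y, hy, rfl⟩, ⟨z, hz, hyz⟩⟩
        dsimp only at hyz
        have hd : up p ≤ y.1.1.deg := by
          rw [hp, up_sup]
          exact sup_le y.2 (by rw [← hyz]; exact z.2)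
        refine ⟨⟨y.1, hd⟩, ⟨hy, ?_⟩, rfl⟩
        have : incl hn ⟨y.1, hd⟩ = z := Subtype.ext hyz.symm
        rwa [this]
    rw [e]
    exact (g.isCompact_tsupport.image continuous_val).inter_right
      (u.isCompact_tsupport.image continuous_val).isClosed
  · intro x hx
    by_contra hne
    refine hx ⟨mem_tsupport fun h0 => hne ?_, mem_tsupport (right_ne_zero_of_mul hne)⟩
    rw [h0, map_zero, zero_mul]

lemma mul_smul_right (h : l + m = n) (a : C₀(Λ.Boundary, ℂ)) (f : Λ.PreX l) (y : Λ.PreX m) :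
    PreX.mul h f (a • y) = a • PreX.mul h f y := by
  refine PreX.ext fun t => ?_
  rw [mul_apply, smul_apply, smul_apply, mul_apply, σ_shiftGE, mul_assoc]

variable [Λ.FinitelyAligned]

lemma inner_eq_transfer (f g : Λ.PreX n) :
    (inner C₀(Λ.Boundary, ℂ) f g) = transfer (cmul (conjMap f) g).toCc := rfl

/-- The adjoint `C_c(∂Λ^{≥n}) → C_c(∂Λ^{≥m})` of the multiplication by `g ∈ C_c(∂Λ^{≥l})`:
`z` is sent to `w ↦ ∑_{σ_l(y) = w} conj(g(y)) z(y)`. -/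
noncomputable def annih (h : l + m = n) (g : Λ.PreX l) (z : Λ.PreX n) : Λ.PreX m :=
  shiftSum h (cmul ((conjMap g).comp ⟨incl h, continuous_incl h⟩) z)

/-- The factor conj(y(σ_l(x))) is constant on the fibres of σ_l, so it may be moved into or out of
the inner sum; summing in stages then identifies the two sides. -/
lemma inner_mul_left (h : l + m = n) (g : Λ.PreX l) (y : Λ.PreX m) (z : Λ.PreX n) :
    (inner C₀(Λ.Boundary, ℂ) (PreX.mul h g y) z) =
      inner C₀(Λ.Boundary, ℂ) y (annih h g z) := by
  rw [inner_eq_transfer, inner_eq_transfer, annih, ← shiftSum_cmul, transfer_shiftSum]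
  congr 2
  refine PreX.ext fun x => ?_
  change conj (g (incl h x) * y (shiftGE h x)) * z x =
    conj (y (shiftGE h x)) * (conj (g (incl h x)) * z x)
  rw [map_mul]; ring

/-- On the fibre of σ_l over w the factor y(σ_l(t)) is y(w), and what remains is the sum defining
⟨g, x⟩(w). The extension by zero loses nothing, as the whole fibre over a point of ∂Λ^{≥m} lies in
∂Λ^{≥n}. -/
lemma annih_mul_apply (h : l + m = n) (g x : Λ.PreX l) (y : Λ.PreX m) (w : Λ.BoundaryGE m) :
    annih h g (PreX.mul h x y) w = (inner C₀(Λ.Boundary, ℂ) g x) w.1 * y w := by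
  rw [annih, shiftSum_apply, inner_apply, ← tsum_mul_right]
  refine tsum_congr ?_
  rintro ⟨t, ht⟩
  obtain ⟨t, rfl, rfl⟩ := exists_incl_eq h t w ht
  rw [extZero_incl]
  change conj (g (incl h t)) * (x (incl h t) * y (shiftGE h t)) = _
  rw [mul_assoc]

/-- In the notation T_f for y ↦ fy, this says T_f T_g^*(xy) = (Θ_{f,g} x)y, so T_f T_g^* has the
defining property of ι(Θ_{f,g}). -/
lemma mul_annih_mul (h : l + m = n) (f g x : Λ.PreX l) (y : Λ.PreX m) :
    PreX.mul h f (annih h g (PreX.mul h x y)) =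
      PreX.mul h ((inner C₀(Λ.Boundary, ℂ) g x) • f) y := by
  refine PreX.ext fun t => ?_
  rw [mul_apply, mul_apply, annih_mul_apply, smul_apply, mul_assoc]
  rfl

lemma annih_add (h : l + m = n) (g : Λ.PreX l) (z z' : Λ.PreX n) :
    annih h g (z + z') = annih h g z + annih h g z' := by
  rw [annih, annih, annih, ← shiftSum_add]
  congr 1
  exact PreX.ext fun x => mul_add _ _ _

lemma annih_smul (h : l + m = n) (g : Λ.PreX l) (c : ℂ) (z : Λ.PreX n) :
    annih h g (c • z) = c • annih h g z := by
  rw [annih, annih, ← shiftSum_smul]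
  congr 1
  exact PreX.ext fun x => mul_left_comm _ _ _

/-- Write F = pq with both factors supported on a. Extend p by zero to ∂Λ^{≥l}, and transport q
along σ_l, which is injective on the paths with initial segment a. -/
lemma SupportedOn.exists_mul_eq (h : l + m = n) {F : Λ.PreX n} {a : Λ.Path}
    (hF : SupportedOn a F) : ∃ (f : Λ.PreX l) (g : Λ.PreX m), PreX.mul h f g = F := by
  obtain ⟨p, q, hpq, h0⟩ := exists_eq_mul F
  have hq : SupportedOn a q := fun x hx => hF x fun hx0 => hx (h0 x hx0).2
  refine ⟨extZero h p, shiftSum h q, PreX.ext fun x => ?_⟩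
  rw [mul_apply, extZero_incl, hpq]
  by_cases hx : head x = a
  · rw [hq.shiftSum_shiftGE h hx]
  -- Here the transported q need not vanish at σ_l(x), because another path in the fibre may begin
  -- with a; but p(x) = 0.
  · have : F x = 0 := by_contra fun hne => hx (hF x hne)
    rw [(h0 x this).1, zero_mul, zero_mul]

/-- Every element of `C_c(∂Λ^{≥n})` is a finite sum of products. -/
lemma exists_sum_mul (h : l + m = n) (F : Λ.PreX n) :
    ∃ (I : Finset Λ.Path) (f : Λ.Path → Λ.PreX l) (g : Λ.Path → Λ.PreX m),
      F = ∑ a ∈ I, PreX.mul h (f a) (g a) := by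
  obtain ⟨I, hI⟩ := exists_sum_restrictHead F
  choose f g hfg using fun a => (supportedOn_restrictHead a F).exists_mul_eq (l := l) (m := m) h
  exact ⟨I, f, g, by simp only [hfg]; exact hI⟩

/-! ### Finite rank of T_g^* T_u at the join of two degrees -/

section Alignment

variable {p m' n' : Fin k → ℕ} (hm : m + m' = p) (hn : n + n' = p)

/-- For `c` supported on a single initial segment the operator
`y ↦ shiftSum (c · (y ∘ σ_n))` from `X_{n'}` to `X_{m'}` has rank one. -/
lemma SupportedOn.exists_shiftSum_eq {c : Λ.PreX p} {a : Λ.Path} (hc : SupportedOn a c) :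
    ∃ (s : Λ.PreX m') (t : Λ.PreX n'), ∀ (y : Λ.PreX n') (F : Λ.PreX p),
      (∀ x, F x = c x * y (shiftGE hn x)) →
        shiftSum hm F = (inner C₀(Λ.Boundary, ℂ) t y) • s := by
  obtain ⟨P, Q, hPQ, h0⟩ := exists_eq_mul c
  have hP : SupportedOn a P := fun x hx => hc x fun hx0 => hx (h0 x hx0).1
  have hQ : SupportedOn a Q := fun x hx => hc x fun hx0 => hx (h0 x hx0).2
  -- If w = σ_m(x) with x beginning with a, then x is unique and the sum at w is P(x) · Q(x)
  -- y(σ_n(x)). The first factor is `shiftSum hm P` at w. The second is ⟨t, y⟩ at σ_p(x) =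
  -- σ_{m'}(w), where t is the conjugate of Q transported along σ_n; the conjugation cancels the one
  -- in the inner product.
  refine ⟨shiftSum hm P, conjugate (shiftSum hn Q), fun y F hF => PreX.ext fun w => ?_⟩
  have hFa : SupportedOn a F := fun x hx => hc x (left_ne_zero_of_mul (hF x ▸ hx))
  rw [smul_apply]
  by_cases hw : ∃ x, shiftGE hm x = w ∧ head x = a
  · obtain ⟨x, rfl, hx⟩ := hw
    let yc : C(Λ.BoundaryGE n', ℂ) := ⟨fun x => y x, y.continuous⟩
    -- G(x) = y(σ_n(x)) Q(x). Summing in stages through σ_n gives ⟨t, y⟩, whereas over σ_p(x)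
    -- directly only the term G(x) occurs.
    let G : Λ.PreX p := cmul (yc.comp ⟨shiftGE hn, continuous_shiftGE hn⟩) Q
    have hG : SupportedOn a G := fun x hx => hQ x (right_ne_zero_of_mul hx)
    have e : (inner C₀(Λ.Boundary, ℂ) (conjugate (shiftSum hn Q)) y) = transfer G.toCc := by
      rw [← transfer_shiftSum hn G, shiftSum_cmul, inner_eq_transfer]
      congr 2
      refine PreX.ext fun x => ?_
      change conj (conj (shiftSum hn Q x)) * y x = y x * shiftSum hn Q x
      rw [Complex.conj_conj, mul_comm]
    rw [hFa.shiftSum_shiftGE hm hx, hP.shiftSum_shiftGE hm hx, e, σ_shiftGE, hG.transfer_σ hx,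
      hF, hPQ]
    change P x * Q x * y (shiftGE hn x) = P x * (y (shiftGE hn x) * Q x)
    ring
  · push Not at hw
    -- No path beginning with a lies over w, so both sides vanish at w.
    have hz : ∀ f : Λ.PreX p, SupportedOn a f → shiftSum hm f w = 0 := by
      intro f hf
      by_contra hne
      obtain ⟨x, hx, hfx⟩ := exists_of_shiftSum_ne_zero hm hne
      exact hw x hx (hf x hfx)
    rw [hz F hFa, hz P hP, zero_mul]

/-- For `p = m ∨ n`, the composite of a creation operator and an annihilation operator has finite
rank. -/
lemma exists_annih_mul_eq (hp : p = m ⊔ n) (g : Λ.PreX m) (u : Λ.PreX n) :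
    ∃ (I : Finset Λ.Path) (s : Λ.Path → Λ.PreX m') (t : Λ.Path → Λ.PreX n'), ∀ y : Λ.PreX n',
      annih hm g (PreX.mul hn u y) = ∑ a ∈ I, (inner C₀(Λ.Boundary, ℂ) (t a) y) • s a := by
  obtain ⟨c, hc⟩ := exists_conj_mul hm hn hp g u
  obtain ⟨I, hI⟩ := exists_sum_restrictHead c
  choose s t hst using fun a => (supportedOn_restrictHead a c).exists_shiftSum_eq hm hn
  refine ⟨I, s, t, fun y => ?_⟩
  let yc : C(Λ.BoundaryGE p, ℂ) := ⟨fun x => y (shiftGE hn x),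
    y.continuous.comp (continuous_shiftGE hn)⟩
  have e : ∀ a, (inner C₀(Λ.Boundary, ℂ) (t a) y) • s a =
      shiftSum hm (cmul yc (restrictHead a c)) :=
    fun a => (hst a y _ fun x => mul_comm _ _).symm
  simp only [e]
  rw [← shiftSum_sum, annih]
  congr 1
  refine PreX.ext fun x => ?_
  rw [sum_apply]
  have e2 : (∑ a ∈ I, cmul yc (restrictHead a c) x) = yc x * c x := by
    simp only [cmul_apply]
    rw [← Finset.mul_sum, ← sum_apply, ← hI]
  rw [e2, hc]
  change conj (g (incl hm x)) * (u (incl hn x) * y (shiftGE hn x)) =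
    y (shiftGE hn x) * (conj (g (incl hm x)) * u (incl hn x))
  ring

end Alignment

end PreX

end KGraph

/-! ### Creation and annihilation operators on the completions -/

namespace KGraph

open UniformSpace HilbertModule

variable {k : ℕ} {Λ : KGraph k} [Λ.FinitelyAligned] {l m n : Fin k → ℕ}

/-- With w = T_g^* z, adjointness gives ‖w‖² = ‖⟨gw, z⟩‖ ≤ ‖g‖ ‖w‖ ‖z‖. The bound is needed to
extend T_g^* to the completion. -/
lemma PreX.norm_annih_le (h : l + m = n) (g : Λ.PreX l) (z : Λ.PreX n) :
    ‖PreX.annih h g z‖ ≤ ‖g‖ * ‖z‖ := by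
  set w := PreX.annih h g z with hw
  have h1 : ‖w‖ ^ 2 ≤ (‖g‖ * ‖z‖) * ‖w‖ := by
    rw [CStarModule.norm_sq_eq C₀(Λ.Boundary, ℂ)]
    nth_rw 2 [hw]
    rw [← PreX.inner_mul_left]
    refine (CStarModule.norm_inner_le (A := C₀(Λ.Boundary, ℂ)) (Λ.PreX n)).trans ?_
    calc _ ≤ ‖g‖ * ‖w‖ * ‖z‖ := by gcongr; exact PreX.norm_mul_le h g w
      _ = _ := by ring
  rcases (norm_nonneg w).eq_or_lt with h0 | h0
  · rw [← h0]; positivity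
  · rw [sq] at h1
    exact le_of_mul_le_mul_right h1 h0

/-- The annihilation operator on compactly supported functions as a bounded operator. -/
noncomputable def PreX.annihL (h : l + m = n) (g : Λ.PreX l) : Λ.PreX n →L[ℂ] Λ.PreX m :=
  LinearMap.mkContinuous
    { toFun := PreX.annih h g
      map_add' := PreX.annih_add h g
      map_smul' := PreX.annih_smul h g } ‖g‖ (PreX.norm_annih_le h g)

namespace X

lemma mul_add (h : l + m = n) (x : Λ.X l) (y y' : Λ.X m) :
    X.mul h x (y + y') = X.mul h x y + X.mul h x y' := by
  induction x, y, y' using Completion.induction_on₃ with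
  | hp =>
    refine isClosed_eq
      ((X.continuous_mul h).comp (continuous_fst.prodMk (continuous_snd.fst.add continuous_snd.snd)))
      (((X.continuous_mul h).comp (continuous_fst.prodMk continuous_snd.fst)).add
        ((X.continuous_mul h).comp (continuous_fst.prodMk continuous_snd.snd)))
  | ih x y y' =>
    rw [← Completion.coe_add, X.mul_coe, X.mul_coe, X.mul_coe, ← Completion.coe_add]
    exact congrArg _ ((PreX.mulₗ h x).map_add y y')

lemma add_mul (h : l + m = n) (x x' : Λ.X l) (y : Λ.X m) :
    X.mul h (x + x') y = X.mul h x y + X.mul h x' y := by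
  induction x, x', y using Completion.induction_on₃ with
  | hp =>
    refine isClosed_eq
      ((X.continuous_mul h).comp ((continuous_fst.add continuous_snd.fst).prodMk continuous_snd.snd))
      (((X.continuous_mul h).comp (continuous_fst.prodMk continuous_snd.snd)).add
        ((X.continuous_mul h).comp (continuous_snd.fst.prodMk continuous_snd.snd)))
  | ih x x' y =>
    rw [← Completion.coe_add, X.mul_coe, X.mul_coe, X.mul_coe, ← Completion.coe_add]
    exact congrArg _ ((PreX.mulₗ h).map_add₂ x x' y)

lemma mul_smul (h : l + m = n) (c : ℂ) (x : Λ.X l) (y : Λ.X m) :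
    X.mul h x (c • y) = c • X.mul h x y := by
  induction x, y using Completion.induction_on₂ with
  | hp =>
    refine isClosed_eq
      ((X.continuous_mul h).comp (continuous_fst.prodMk (continuous_snd.const_smul c)))
      ((X.continuous_mul h).const_smul c)
  | ih x y =>
    rw [← Completion.coe_smul, X.mul_coe, X.mul_coe, ← Completion.coe_smul]
    exact congrArg _ ((PreX.mulₗ h x).map_smul c y)

lemma smul_mul (h : l + m = n) (c : ℂ) (x : Λ.X l) (y : Λ.X m) :
    X.mul h (c • x) y = c • X.mul h x y := by
  induction x, y using Completion.induction_on₂ with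
  | hp =>
    refine isClosed_eq
      ((X.continuous_mul h).comp ((continuous_fst.const_smul c).prodMk continuous_snd))
      ((X.continuous_mul h).const_smul c)
  | ih x y =>
    rw [← Completion.coe_smul, X.mul_coe, X.mul_coe, ← Completion.coe_smul]
    exact congrArg _ ((PreX.mulₗ h).map_smul₂ c x y)

lemma norm_mul_le (h : l + m = n) (x : Λ.X l) (y : Λ.X m) : ‖X.mul h x y‖ ≤ ‖x‖ * ‖y‖ := by
  induction x, y using Completion.induction_on₂ with
  | hp =>
    exact isClosed_le (X.continuous_mul h).norm (continuous_fst.norm.mul continuous_snd.norm)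
  | ih x y =>
    rw [X.mul_coe, Completion.norm_coe, Completion.norm_coe, Completion.norm_coe]
    exact PreX.norm_mul_le h x y

/-- The creation operator `y ↦ xy`. -/
noncomputable def creation (h : l + m = n) (x : Λ.X l) : Λ.X m →L[ℂ] Λ.X n :=
  LinearMap.mkContinuous ⟨⟨X.mul h x, mul_add h x⟩, fun c => mul_smul h c x⟩ ‖x‖ (norm_mul_le h x)

lemma creation_apply (h : l + m = n) (x : Λ.X l) (y : Λ.X m) : creation h x y = X.mul h x y := rfl

lemma norm_creation_le (h : l + m = n) (x : Λ.X l) : ‖creation (m := m) h x‖ ≤ ‖x‖ :=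
  LinearMap.mkContinuous_norm_le _ (norm_nonneg _) _

/-- The annihilation operator, the adjoint of `y ↦ gy`, for `g ∈ C_c(∂Λ^{≥l})`. -/
noncomputable def annihilation (h : l + m = n) (g : Λ.PreX l) : Λ.X n →L[ℂ] Λ.X m :=
  ((Completion.toComplL : Λ.PreX m →L[ℂ] Λ.X m).comp (PreX.annihL h g)).extend
    (Completion.toComplL : Λ.PreX n →L[ℂ] Λ.X n)

lemma annihilation_coe (h : l + m = n) (g : Λ.PreX l) (z : Λ.PreX n) :
    annihilation h g (z : Λ.X n) = ((PreX.annih h g z : Λ.PreX m) : Λ.X m) :=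
  ContinuousLinearMap.extend_eq
    ((Completion.toComplL : Λ.PreX m →L[ℂ] Λ.X m).comp (PreX.annihL h g))
    (e := (Completion.toComplL : Λ.PreX n →L[ℂ] Λ.X n))
    Completion.denseRange_coe (Completion.isUniformInducing_coe _) z

lemma inner_creation_left (h : l + m = n) (g : Λ.PreX l) (y : Λ.X m) (z : Λ.X n) :
    (inner C₀(Λ.Boundary, ℂ) (creation h (g : Λ.X l) y) z) =
      inner C₀(Λ.Boundary, ℂ) y (annihilation h g z) := by
  induction y, z using Completion.induction_on₂ with
  | hp =>
    exact isClosed_eq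
      (Continuous.inner_completion ((creation h (g : Λ.X l)).continuous.comp continuous_fst)
        continuous_snd)
      (Continuous.inner_completion continuous_fst
        ((annihilation h g).continuous.comp continuous_snd))
  | ih y z =>
    rw [creation_apply, X.mul_coe, annihilation_coe, inner_coe, inner_coe, PreX.inner_mul_left]

lemma inner_annihilation_left (h : l + m = n) (g : Λ.PreX l) (y : Λ.X m) (z : Λ.X n) :
    (inner C₀(Λ.Boundary, ℂ) (annihilation h g z) y) =
      inner C₀(Λ.Boundary, ℂ) z (creation h (g : Λ.X l) y) := by
  rw [← CStarModule.star_inner (A := C₀(Λ.Boundary, ℂ)) y, ← inner_creation_left]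
  exact CStarModule.star_inner (A := C₀(Λ.Boundary, ℂ)) (E := Λ.X n) _ _

/-- Operators that agree on all products `xy` are equal. -/
lemma eq_of_eq_on_mul (h : l + m = n) {E : Type*} [NormedAddCommGroup E] [NormedSpace ℂ E]
    {S T : Λ.X n →L[ℂ] E}
    (hST : ∀ (x : Λ.PreX l) (y : Λ.PreX m), S (X.mul h (x : Λ.X l) (y : Λ.X m)) =
      T (X.mul h (x : Λ.X l) (y : Λ.X m))) : S = T := by
  ext z
  induction z using Completion.induction_on with
  | hp => exact isClosed_eq S.continuous T.continuous
  | ih z =>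
    -- After reduction to the dense subspace C_c(∂Λ^{≥n}), every vector is a finite sum of products,
    -- and linearity suffices.
    obtain ⟨I, f, g, rfl⟩ := PreX.exists_sum_mul h z
    have e : ((∑ a ∈ I, PreX.mul h (f a) (g a) : Λ.PreX n) : Λ.X n) =
        ∑ a ∈ I, X.mul h (f a : Λ.X l) (g a : Λ.X m) := by
      simp only [X.mul_coe]
      exact map_sum (Completion.toComplL : Λ.PreX n →L[ℂ] Λ.X n) _ _
    rw [e, map_sum, map_sum]
    exact Finset.sum_congr rfl fun a _ => hST _ _

lemma creation_annihilation_mul (h : l + m = n) (f g : Λ.PreX l) (x : Λ.X l) (y : Λ.X m) :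
    creation h (f : Λ.X l) (annihilation h g (X.mul h x y)) =
      X.mul h (rankOne C₀(Λ.Boundary, ℂ) (f : Λ.X l) (g : Λ.X l) x) y := by
  induction x, y using Completion.induction_on₂ with
  | hp =>
    refine isClosed_eq ?_ ?_
    · exact ((creation h (f : Λ.X l)).continuous.comp (annihilation h g).continuous).comp
        (X.continuous_mul h)
    · exact (X.continuous_mul h).comp (((ContinuousLinearMap.continuous _).comp
        continuous_fst).prodMk continuous_snd)
  | ih x y =>
    rw [X.mul_coe, annihilation_coe, creation_apply, X.mul_coe, rankOne_apply, inner_coe,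
      ← Completion.coe_smul, X.mul_coe, PreX.mul_annih_mul]

end X

end KGraph

/-- Take roots: with N = 2^(j+1) the hypothesis reads (r/s)^N ≤ C/s when s > 0, and the powers of a
number above 1 are unbounded. -/
lemma le_of_forall_pow_two_pow_le {r s C : ℝ} (hs : 0 ≤ s)
    (h : ∀ j : ℕ, r ^ 2 ^ (j + 1) ≤ C * s ^ (2 ^ (j + 1) - 1)) : r ≤ s := by
  by_contra! hlt
  rcases hs.eq_or_lt with rfl | hs
  -- When s = 0 the exponent 2 - 1 = 1 is still positive, so the case j = 0 reads r² ≤ 0.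
  · have := h 0
    norm_num at this
    rw [this] at hlt
    exact lt_irrefl _ hlt
  · obtain ⟨j, hj⟩ := pow_unbounded_of_one_lt (C / s) ((one_lt_div hs).2 hlt)
    have hM : j ≤ 2 ^ (j + 1) := (Nat.le_succ j).trans Nat.lt_two_pow_self.le
    have h1 := hj.trans_le (pow_le_pow_right₀ ((one_lt_div hs).2 hlt).le hM)
    rw [div_pow, div_lt_div_iff₀ hs (pow_pos hs _)] at h1
    have h2 := mul_le_mul_of_nonneg_right (h j) hs.le
    rw [mul_assoc, ← pow_succ, Nat.sub_add_cancel Nat.one_le_two_pow] at h2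
    exact absurd h1 h2.not_gt

/-! ### Adjoints and norms of operators on Hilbert modules -/

namespace HilbertModule

section Adjoint

variable {A E : Type*} [NonUnitalCommCStarAlgebra A] [PartialOrder A]
  [NormedAddCommGroup E] [NormedSpace ℂ E] [SMul A E] [CStarModule A E]

variable (A) in
/-- `T'` is the adjoint of `T`. -/
def IsAdjointPair (T T' : E →L[ℂ] E) : Prop :=
  ∀ x y : E, (inner A (T x) y : A) = inner A x (T' y)

lemma IsAdjointPair.symm {T T' : E →L[ℂ] E} (h : IsAdjointPair A T T') :
    IsAdjointPair A T' T := by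
  intro x y
  rw [← CStarModule.star_inner (A := A), ← h, CStarModule.star_inner]

lemma IsAdjointPair.mul {S S' T T' : E →L[ℂ] E} (hS : IsAdjointPair A S S')
    (hT : IsAdjointPair A T T') : IsAdjointPair A (S * T) (T' * S') := by
  intro x y
  exact (hS _ _).trans (hT _ _)

lemma IsAdjointPair.add {S S' T T' : E →L[ℂ] E} (hS : IsAdjointPair A S S')
    (hT : IsAdjointPair A T T') : IsAdjointPair A (S + T) (S' + T') := by
  intro x y
  simp only [_root_.add_apply, CStarModule.inner_add_left,
    CStarModule.inner_add_right, hS x y, hT x y]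

lemma IsAdjointPair.smul {T T' : E →L[ℂ] E} (hT : IsAdjointPair A T T') (c : ℂ) :
    IsAdjointPair A (c • T) (star c • T') := by
  intro x y
  simp only [_root_.smul_apply, CStarModule.inner_smul_left_complex,
    CStarModule.inner_smul_right_complex, hT x y]

lemma isAdjointPair_zero : IsAdjointPair A (0 : E →L[ℂ] E) 0 := by
  intro x y
  simp

lemma IsAdjointPair.pow {T : E →L[ℂ] E} (h : IsAdjointPair A T T) (n : ℕ) :
    IsAdjointPair A (T ^ n) (T ^ n) := by
  induction n with
  | zero => intro x y; rfl
  | succ n ih =>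
    have := ih.mul h
    rwa [← pow_succ, ← pow_succ'] at this

variable [StarOrderedRing A]

lemma isAdjointPair_rankOne (x y : E) :
    IsAdjointPair A (rankOne A x y) (rankOne A y x) := by
  intro z w
  rw [rankOne_apply, rankOne_apply, CStarModule.inner_op_smul_left,
    CStarModule.inner_op_smul_right, CStarModule.star_inner, mul_comm]

/-- The C*-inequality: ‖Tx‖² = ‖⟨x, T'Tx⟩‖ ≤ ‖T'T‖ ‖x‖² by Cauchy–Schwarz. -/
lemma IsAdjointPair.norm_sq_le {T T' : E →L[ℂ] E} (h : IsAdjointPair A T T') :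
    ‖T‖ ^ 2 ≤ ‖T' * T‖ := by
  refine (Real.le_sqrt (norm_nonneg _) (norm_nonneg _)).1 ?_
  refine T.opNorm_le_bound (Real.sqrt_nonneg _) fun x => ?_
  refine le_of_sq_le_sq ?_ (by positivity)
  rw [mul_pow, Real.sq_sqrt (norm_nonneg _), CStarModule.norm_sq_eq A (x := T x), h]
  refine (CStarModule.norm_inner_le (A := A) E).trans ?_
  calc ‖x‖ * ‖T' (T x)‖ ≤ ‖x‖ * (‖T' * T‖ * ‖x‖) := by
        gcongr; exact (T' * T).le_opNorm x
    _ = _ := by ring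

/-- Applied to T', the C*-inequality gives ‖T'‖² ≤ ‖TT'‖ ≤ ‖T‖ ‖T'‖. -/
lemma IsAdjointPair.norm_le {T T' : E →L[ℂ] E} (h : IsAdjointPair A T T') : ‖T'‖ ≤ ‖T‖ := by
  have h1 := h.symm.norm_sq_le.trans (norm_mul_le T T')
  rcases (norm_nonneg T').eq_or_lt with h0 | h0
  · rw [← h0]; positivity
  · rw [sq] at h1
    exact le_of_mul_le_mul_right h1 h0

/-- Repeated squaring: powers of a self-adjoint operator are self-adjoint, so the C*-inequality
applies again at each stage. -/
lemma IsAdjointPair.norm_pow_two_pow_le {T : E →L[ℂ] E} (h : IsAdjointPair A T T) (j : ℕ) :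
    ‖T‖ ^ 2 ^ j ≤ ‖T ^ 2 ^ j‖ := by
  induction j with
  | zero => simp
  | succ j ih =>
    rw [pow_succ 2 j, pow_mul, pow_mul, sq (T ^ 2 ^ j)]
    exact (pow_le_pow_left₀ (by positivity) ih 2).trans (h.pow _).norm_sq_le

lemma norm_pow_mul_le (R Q : E →L[ℂ] E) (n : ℕ) : ‖R ^ n * Q‖ ≤ ‖R‖ ^ n * ‖Q‖ := by
  induction n with
  | zero => simp
  | succ n ih =>
    rw [pow_succ', pow_succ', mul_assoc, mul_assoc]
    exact (norm_mul_le _ _).trans (by gcongr)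

/-- The adjointable operators form a closed set. -/
lemma isClosed_isAdjointable [CompleteSpace E] :
    IsClosed {T : E →L[ℂ] E | IsAdjointable A T} := by
  -- The pairs (T, T^*) form a closed, hence complete, subgroup. Because ‖T^*‖ ≤ ‖T‖, the first
  -- projection is antilipschitz on it in the maximum norm, so its range, the set of adjointable
  -- operators, is closed.
  let G : AddSubgroup ((E →L[ℂ] E) × (E →L[ℂ] E)) :=
    { carrier := {p | IsAdjointPair A p.1 p.2}
      add_mem' := fun hp hq => hp.add hq
      zero_mem' := isAdjointPair_zero
      neg_mem' := fun {p} hp => by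
        have := IsAdjointPair.smul (A := A) hp (-1)
        simpa using this }
  have hG : IsClosed (G : Set ((E →L[ℂ] E) × (E →L[ℂ] E))) := by
    have e : (G : Set ((E →L[ℂ] E) × (E →L[ℂ] E))) =
        ⋂ x : E, ⋂ y : E, {p | (inner A (p.1 x) y : A) = inner A x (p.2 y)} := by
      ext p
      simp only [mem_iInter]
      rfl
    rw [e]
    refine isClosed_iInter fun x => isClosed_iInter fun y => ?_
    have hc : Continuous fun p : E × E => (inner A p.1 p.2 : A) := CStarModule.continuous_inner
    refine isClosed_eq (hc.comp (((ContinuousLinearMap.apply ℂ E x).continuous.comp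
      continuous_fst).prodMk continuous_const)) (hc.comp (continuous_const.prodMk
        ((ContinuousLinearMap.apply ℂ E y).continuous.comp continuous_snd)))
  have : CompleteSpace G := hG.completeSpace_coe
  let φ : G →+ (E →L[ℂ] E) := (AddMonoidHom.fst _ _).comp G.subtype
  have h1 : AntilipschitzWith 1 φ := by
    refine AddMonoidHomClass.antilipschitz_of_bound φ fun p => ?_
    rw [NNReal.coe_one, one_mul]
    exact max_le le_rfl (IsAdjointPair.norm_le (A := A) p.2)
  have h2 : UniformContinuous φ := uniformContinuous_fst.comp uniformContinuous_subtype_val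
  have h3 : range φ = {T : E →L[ℂ] E | IsAdjointable A T} := by
    ext T
    constructor
    · rintro ⟨p, rfl⟩
      exact ⟨p.1.2, p.2⟩
    · rintro ⟨T', hT⟩
      exact ⟨⟨(T, T'), hT⟩, rfl⟩
  rw [← h3]
  exact h1.isClosed_range h2

lemma norm_rankOne_le (x y : E) : ‖rankOne A x y‖ ≤ ‖x‖ * ‖y‖ := by
  rw [mul_comm]
  exact LinearMap.mkContinuous_norm_le _ (by positivity) _

lemma continuous_rankOne_left (y : E) : Continuous fun x : E => rankOne A x y := by
  let φ : E →+ (E →L[ℂ] E) := AddMonoidHom.mk' (fun x => rankOne A x y) fun x x' => by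
    ext z; simp only [_root_.add_apply, rankOne_apply, smul_add']
  exact AddMonoidHomClass.continuous_of_bound φ ‖y‖ fun x =>
    (norm_rankOne_le x y).trans_eq (mul_comm _ _)

lemma continuous_rankOne_right (x : E) : Continuous fun y : E => rankOne A x y := by
  let φ : E →+ (E →L[ℂ] E) := AddMonoidHom.mk' (fun y => rankOne A x y) fun y y' => by
    ext z
    simp only [_root_.add_apply, rankOne_apply, CStarModule.inner_add_left,
      add_smul']
  exact AddMonoidHomClass.continuous_of_bound φ ‖x‖ fun y => norm_rankOne_le x y

lemma rankOne_mem_compactOperators (x y : E) : rankOne A x y ∈ compactOperators A E :=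
  Submodule.le_topologicalClosure _ (Submodule.subset_span ⟨x, y, rfl⟩)

end Adjoint

end HilbertModule

/-! ### The map ι on compact operators -/

namespace KGraph

open UniformSpace HilbertModule

variable {k : ℕ} {Λ : KGraph k} [Λ.FinitelyAligned] {l m n : Fin k → ℕ}

lemma isAdjointPair_creation_annihilation (h : l + m = n) (f g : Λ.PreX l) :
    IsAdjointPair C₀(Λ.Boundary, ℂ)
      (X.creation h (f : Λ.X l) ∘L X.annihilation h g : Λ.Op n)
      (X.creation h (g : Λ.X l) ∘L X.annihilation h f) := by
  intro x y
  exact (X.inner_creation_left h f _ _).trans (X.inner_annihilation_left h g _ _)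

variable (Λ) in
/-- The graph of `ι` on the operators of finite rank: the span of all pairs
`(Θ_{f,g}, ι(Θ_{f,g}))`. -/
noncomputable def iotaGraph (h : l + m = n) : Submodule ℂ (Λ.Op l × Λ.Op n) :=
  Submodule.span ℂ {p | ∃ f g : Λ.PreX l,
    p = (rankOne C₀(Λ.Boundary, ℂ) (f : Λ.X l) (g : Λ.X l),
      X.creation h (f : Λ.X l) ∘L X.annihilation h g)}

/-- For fixed x and y the relation is linear and closed in the pair p, so it passes from the
generators to the closure of their span. -/
lemma iotaGraph_apply_mul (h : l + m = n) {p : Λ.Op l × Λ.Op n}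
    (hp : p ∈ (Λ.iotaGraph h).topologicalClosure) (x : Λ.X l) (y : Λ.X m) :
    p.2 (X.mul h x y) = X.mul h (p.1 x) y := by
  let V : Submodule ℂ (Λ.Op l × Λ.Op n) :=
    { carrier := {p | p.2 (X.mul h x y) = X.mul h (p.1 x) y}
      add_mem' := fun {p q} hp hq => by
        change p.2 _ + q.2 _ = X.mul h (p.1 x + q.1 x) y
        rw [X.add_mul, show p.2 _ = _ from hp, show q.2 _ = _ from hq]
      zero_mem' := by
        change (0 : Λ.X n) = X.mul h 0 y
        have := X.smul_mul h 0 (0 : Λ.X l) y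
        rw [zero_smul, zero_smul] at this
        exact this.symm
      smul_mem' := fun c p hp => by
        change c • p.2 _ = X.mul h (c • p.1 x) y
        rw [X.smul_mul, show p.2 _ = _ from hp] }
  have hV : IsClosed (V : Set (Λ.Op l × Λ.Op n)) := by
    refine isClosed_eq ((ContinuousLinearMap.apply ℂ (Λ.X n) (X.mul h x y)).continuous.comp
      continuous_snd) ((X.continuous_mul h).comp (((ContinuousLinearMap.apply ℂ (Λ.X l)
        x).continuous.comp continuous_fst).prodMk continuous_const))
  refine Submodule.topologicalClosure_minimal _ (Submodule.span_le.2 ?_) hV hp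
  rintro _ ⟨f, g, rfl⟩
  exact X.creation_annihilation_mul h f g x y

/-- Taking adjoints exchanges f and g in both entries of a generating pair. -/
lemma exists_adjoint_mem_iotaGraph (h : l + m = n) {p : Λ.Op l × Λ.Op n}
    (hp : p ∈ Λ.iotaGraph h) : ∃ q ∈ Λ.iotaGraph h,
      IsAdjointPair C₀(Λ.Boundary, ℂ) p.1 q.1 ∧ IsAdjointPair C₀(Λ.Boundary, ℂ) p.2 q.2 := by
  induction hp using Submodule.span_induction with
  | mem p hp =>
    obtain ⟨f, g, rfl⟩ := hp
    exact ⟨_, Submodule.subset_span ⟨g, f, rfl⟩, isAdjointPair_rankOne _ _,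
      isAdjointPair_creation_annihilation h f g⟩
  | zero => exact ⟨0, Submodule.zero_mem _, isAdjointPair_zero, isAdjointPair_zero⟩
  | add p p' _ _ hp hp' =>
    obtain ⟨q, hq, h1, h2⟩ := hp
    obtain ⟨q', hq', h1', h2'⟩ := hp'
    exact ⟨q + q', Submodule.add_mem _ hq hq', h1.add h1', h2.add h2'⟩
  | smul c p _ hp =>
    obtain ⟨q, hq, h1, h2⟩ := hp
    exact ⟨star c • q, Submodule.smul_mem _ _ hq, h1.smul c, h2.smul c⟩

/-- If Q' acts on products through Q, then Q' T_f = T_{Qf}, so ‖Q' T_f T_g^*‖ ≤ ‖Q‖ ‖f‖ ‖T_g^*‖. The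
constant depends on how p is written as a combination of generators but not on Q, and so it
disappears when roots are taken. -/
lemma exists_norm_mul_snd_le (h : l + m = n) {p : Λ.Op l × Λ.Op n} (hp : p ∈ Λ.iotaGraph h) :
    ∃ C : ℝ, 0 ≤ C ∧ ∀ (Q : Λ.Op l) (Q' : Λ.Op n),
      (∀ (x : Λ.X l) (y : Λ.X m), Q' (X.mul h x y) = X.mul h (Q x) y) →
        ‖Q' * p.2‖ ≤ C * ‖Q‖ := by
  induction hp using Submodule.span_induction with
  | mem p hp =>
    obtain ⟨f, g, rfl⟩ := hp
    refine ⟨‖(f : Λ.X l)‖ * ‖X.annihilation h g‖, by positivity, fun Q Q' hQ => ?_⟩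
    have e : Q' * (X.creation h (f : Λ.X l) ∘L X.annihilation h g) =
        X.creation h (Q f) ∘L X.annihilation h g := by
      ext z
      exact hQ _ _
    rw [e]
    calc _ ≤ ‖X.creation (m := m) h (Q f)‖ * ‖X.annihilation h g‖ :=
          ContinuousLinearMap.opNorm_comp_le _ _
      _ ≤ (‖Q‖ * ‖(f : Λ.X l)‖) * ‖X.annihilation h g‖ := by
          gcongr
          exact (X.norm_creation_le h _).trans (Q.le_opNorm _)
      _ = _ := by ring
  | zero => exact ⟨0, le_rfl, fun Q Q' _ => by simp⟩
  | add p p' _ _ hp hp' =>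
    obtain ⟨C, hC, h1⟩ := hp
    obtain ⟨C', hC', h2⟩ := hp'
    refine ⟨C + C', add_nonneg hC hC', fun Q Q' hQ => ?_⟩
    rw [Prod.snd_add, _root_.mul_add, _root_.add_mul]
    exact (norm_add_le _ _).trans (add_le_add (h1 Q Q' hQ) (h2 Q Q' hQ))
  | smul c p _ hp =>
    obtain ⟨C, hC, h1⟩ := hp
    refine ⟨‖c‖ * C, by positivity, fun Q Q' hQ => ?_⟩
    rw [show (c • p).2 = c • p.2 from rfl, mul_smul_comm, norm_smul, mul_assoc]
    exact mul_le_mul_of_nonneg_left (h1 Q Q' hQ) (norm_nonneg _)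

/-- Let q be the pair of adjoints of p and N = 2^j. The C*-inequality gives ‖p.2‖^(2N) ≤ ‖(q.2
p.2)^N‖. Splitting off the last factor p.2 leaves an operator that acts on products through (q.1
p.1)^(N-1) q.1, so the right side is at most C ‖p.1‖^(2N-1) with C independent of N. Roots finish
the proof. -/
lemma norm_snd_le_of_mem_iotaGraph (h : l + m = n) {p : Λ.Op l × Λ.Op n}
    (hp : p ∈ Λ.iotaGraph h) : ‖p.2‖ ≤ ‖p.1‖ := by
  obtain ⟨q, hq, h1, h2⟩ := exists_adjoint_mem_iotaGraph h hp
  obtain ⟨C, hC, hbound⟩ := exists_norm_mul_snd_le h hp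
  have hpm := iotaGraph_apply_mul h ((Λ.iotaGraph h).le_topologicalClosure hp)
  have hqm := iotaGraph_apply_mul h ((Λ.iotaGraph h).le_topologicalClosure hq)
  have hR : ∀ (N : ℕ) (x : Λ.X l) (y : Λ.X m), ((q.2 * p.2) ^ N * q.2) (X.mul h x y) =
      X.mul h (((q.1 * p.1) ^ N * q.1) x) y := by
    intro N x y
    induction N with
    | zero => simpa using hqm x y
    | succ N ih =>
      rw [pow_succ', mul_assoc, pow_succ', mul_assoc]
      change q.2 (p.2 (((q.2 * p.2) ^ N * q.2) (X.mul h x y))) = _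
      rw [ih, hpm, hqm]
      rfl
  refine le_of_forall_pow_two_pow_le (C := C) (norm_nonneg _) fun j => ?_
  -- The exponent is at least 1, so one factor q.2 p.2 can be split off and the natural subtraction
  -- is harmless.
  have hN : 2 ^ j = (2 ^ j - 1) + 1 := (Nat.sub_add_cancel Nat.one_le_two_pow).symm
  calc ‖p.2‖ ^ 2 ^ (j + 1) = (‖p.2‖ ^ 2) ^ 2 ^ j := by rw [← pow_mul, pow_succ' 2 j]
    _ ≤ ‖q.2 * p.2‖ ^ 2 ^ j := pow_le_pow_left₀ (by positivity) h2.norm_sq_le _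
    _ ≤ ‖(q.2 * p.2) ^ 2 ^ j‖ := (h2.symm.mul h2).norm_pow_two_pow_le j
    _ = ‖((q.2 * p.2) ^ (2 ^ j - 1) * q.2) * p.2‖ := by
        rw [mul_assoc, ← pow_succ, ← hN]
    _ ≤ C * ‖(q.1 * p.1) ^ (2 ^ j - 1) * q.1‖ := hbound _ _ (hR _)
    _ ≤ C * ((‖p.1‖ * ‖p.1‖) ^ (2 ^ j - 1) * ‖p.1‖) := by
        gcongr
        refine (norm_pow_mul_le _ _ _).trans ?_
        gcongr
        · exact (norm_mul_le _ _).trans (by gcongr; exact h1.norm_le)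
        · exact h1.norm_le
    _ = C * ‖p.1‖ ^ (2 ^ (j + 1) - 1) := by
        rw [← sq, ← pow_mul, ← pow_succ]
        congr 2
        rw [pow_succ' 2 j]
        omega

lemma norm_snd_le_of_mem_closure (h : l + m = n) {p : Λ.Op l × Λ.Op n}
    (hp : p ∈ (Λ.iotaGraph h).topologicalClosure) : ‖p.2‖ ≤ ‖p.1‖ := by
  have hcl : IsClosed {p : Λ.Op l × Λ.Op n | ‖p.2‖ ≤ ‖p.1‖} :=
    isClosed_le continuous_snd.norm continuous_fst.norm
  exact closure_minimal (fun p hp => norm_snd_le_of_mem_iotaGraph h hp) hcl hp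

lemma isAdjointable_snd_of_mem_closure (h : l + m = n) {p : Λ.Op l × Λ.Op n}
    (hp : p ∈ (Λ.iotaGraph h).topologicalClosure) :
    IsAdjointable C₀(Λ.Boundary, ℂ) p.2 := by
  have hcl : IsClosed {p : Λ.Op l × Λ.Op n | IsAdjointable C₀(Λ.Boundary, ℂ) p.2} :=
    (isClosed_isAdjointable (A := C₀(Λ.Boundary, ℂ)) (E := Λ.X n)).preimage continuous_snd
  refine closure_minimal (fun p hp => ?_) hcl hp
  obtain ⟨q, -, -, hq⟩ := exists_adjoint_mem_iotaGraph h hp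
  exact ⟨q.2, hq⟩

/-- Every compact operator on `X_l` lies in the domain of the closure of the graph of `ι`. -/
lemma exists_mem_closure_iotaGraph (h : l + m = n) {S : Λ.Op l} (hS : S ∈ Λ.compacts l) :
    ∃ S' : Λ.Op n, (S, S') ∈ (Λ.iotaGraph h).topologicalClosure := by
  -- By the contraction estimate the projection of the closed graph to its first entry is
  -- antilipschitz. Its domain is complete, so its range is closed, and it remains to find the
  -- rank-one operators in it.
  let φ : (Λ.iotaGraph h).topologicalClosure →ₗ[ℂ] Λ.Op l :=
    (LinearMap.fst ℂ (Λ.Op l) (Λ.Op n)).comp (Submodule.subtype _)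
  have h1 : AntilipschitzWith 1 φ := by
    refine AddMonoidHomClass.antilipschitz_of_bound φ fun p => ?_
    rw [NNReal.coe_one, one_mul]
    exact max_le le_rfl (norm_snd_le_of_mem_closure h p.2)
  have h2 : UniformContinuous φ := uniformContinuous_fst.comp uniformContinuous_subtype_val
  have hcl : IsClosed (LinearMap.range φ : Set (Λ.Op l)) := by
    rw [LinearMap.coe_range]
    exact h1.isClosed_range h2
  -- The generators provide Θ_{x,y} only for compactly supported x and y; continuity in each vector
  -- separately gives the rest.
  have hr : ∀ x y : Λ.X l, rankOne C₀(Λ.Boundary, ℂ) x y ∈ LinearMap.range φ := by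
    intro x y
    induction x using Completion.induction_on with
    | hp => exact hcl.preimage (continuous_rankOne_left y)
    | ih x =>
      induction y using Completion.induction_on with
      | hp => exact hcl.preimage (continuous_rankOne_right (x : Λ.X l))
      | ih y =>
        exact ⟨⟨_, (Λ.iotaGraph h).le_topologicalClosure (Submodule.subset_span ⟨x, y, rfl⟩)⟩, rfl⟩
  have hle : Λ.compacts l ≤ LinearMap.range φ := by
    refine Submodule.topologicalClosure_minimal _ (Submodule.span_le.2 ?_) hcl
    rintro _ ⟨x, y, rfl⟩
    exact hr x y
  obtain ⟨⟨⟨S₀, S'⟩, hmem⟩, rfl⟩ := hle hS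
  exact ⟨S', hmem⟩

/-! ### Compactness of the product -/

section Product

variable {m' n' q : Fin k → ℕ} (hm : m + m' = q) (hn : n + n' = q)

/-- Writing T_g^* T_u y = ∑_a s_a · ⟨t_a, y⟩, the identity T_f Θ_{s,t} T_v^* = Θ_{fs,vt} turns the
product into ∑_a Θ_{f s_a, v t_a}. -/
lemma comp_mem_compacts_of_generators (hq : q = m ⊔ n) (f g : Λ.PreX m) (u v : Λ.PreX n) :
    ((X.creation hm (f : Λ.X m) ∘L X.annihilation hm g : Λ.Op q) ∘L
      (X.creation hn (u : Λ.X n) ∘L X.annihilation hn v)) ∈ Λ.compacts q := by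
  obtain ⟨I, s, t, hst⟩ := PreX.exists_annih_mul_eq hm hn hq g u
  have e : ((X.creation hm (f : Λ.X m) ∘L X.annihilation hm g : Λ.Op q) ∘L
      (X.creation hn (u : Λ.X n) ∘L X.annihilation hn v)) =
      ∑ a ∈ I, rankOne C₀(Λ.Boundary, ℂ) ((PreX.mul hm f (s a) : Λ.PreX q) : Λ.X q)
        ((PreX.mul hn v (t a) : Λ.PreX q) : Λ.X q) := by
    ext z
    induction z using Completion.induction_on with
    | hp => exact isClosed_eq (ContinuousLinearMap.continuous _) (ContinuousLinearMap.continuous _)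
    | ih z =>
      have h1 : ∀ a, rankOne C₀(Λ.Boundary, ℂ) ((PreX.mul hm f (s a) : Λ.PreX q) : Λ.X q)
          ((PreX.mul hn v (t a) : Λ.PreX q) : Λ.X q) (z : Λ.X q) =
          ((PreX.mulₗ hm f ((inner C₀(Λ.Boundary, ℂ) (t a) (PreX.annih hn v z)) • s a) :
            Λ.PreX q) : Λ.X q) := fun a => by
        rw [rankOne_apply, inner_coe, PreX.inner_mul_left, ← Completion.coe_smul,
          ← PreX.mul_smul_right]
        rfl
      rw [_root_.sum_apply]
      simp only [h1]
      simp only [ContinuousLinearMap.comp_apply]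
      rw [X.annihilation_coe, X.creation_apply hn, X.mul_coe, X.annihilation_coe, hst,
        X.creation_apply, X.mul_coe]
      change Completion.toComplL (𝕜 := ℂ) (PreX.mulₗ hm f _) = _
      rw [map_sum, map_sum]
      rfl
  rw [e]
  exact Submodule.sum_mem _ fun a _ => rankOne_mem_compactOperators _ _

/-- Composition is linear and continuous in each variable and the compact operators are closed, so
the factors can be reduced to generators one at a time. -/
lemma comp_mem_compacts (hq : q = m ⊔ n) {p : Λ.Op m × Λ.Op q} {p' : Λ.Op n × Λ.Op q}
    (hp : p ∈ (Λ.iotaGraph hm).topologicalClosure)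
    (hp' : p' ∈ (Λ.iotaGraph hn).topologicalClosure) : p.2 ∘L p'.2 ∈ Λ.compacts q := by
  have hcl : IsClosed (Λ.compacts q : Set (Λ.Op q)) :=
    Submodule.isClosed_topologicalClosure _
  have key : ∀ (f g : Λ.PreX m),
      ((X.creation hm (f : Λ.X m) ∘L X.annihilation hm g : Λ.Op q) ∘L p'.2) ∈ Λ.compacts q := by
    intro f g
    let L : (Λ.Op n × Λ.Op q) →L[ℂ] Λ.Op q :=
      (ContinuousLinearMap.compL ℂ (Λ.X q) (Λ.X q) (Λ.X q)
        (X.creation hm (f : Λ.X m) ∘L X.annihilation hm g)).comp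
        (ContinuousLinearMap.snd ℂ (Λ.Op n) (Λ.Op q))
    refine Submodule.topologicalClosure_minimal (Λ.iotaGraph hn)
      (t := (Λ.compacts q).comap L.toLinearMap) (Submodule.span_le.2 ?_)
      (hcl.preimage L.continuous) hp'
    rintro _ ⟨u, v, rfl⟩
    exact comp_mem_compacts_of_generators hm hn hq f g u v
  let L : (Λ.Op m × Λ.Op q) →L[ℂ] Λ.Op q :=
    ((ContinuousLinearMap.compL ℂ (Λ.X q) (Λ.X q) (Λ.X q)).flip p'.2).comp
      (ContinuousLinearMap.snd ℂ (Λ.Op m) (Λ.Op q))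
  refine Submodule.topologicalClosure_minimal (Λ.iotaGraph hm)
    (t := (Λ.compacts q).comap L.toLinearMap) (Submodule.span_le.2 ?_)
    (hcl.preimage L.continuous) hp
  rintro _ ⟨f, g, rfl⟩
  exact key f g

end Product

/-! ### Existence and uniqueness of ι, and the theorem -/

lemma IsIota.unique {q : Fin k → ℕ} (hmq : m ≤ q) {S : Λ.Op m} {S' S'' : Λ.Op q}
    (h' : Λ.IsIota hmq S S') (h'' : Λ.IsIota hmq S S'') : S' = S'' :=
  X.eq_of_eq_on_mul (add_tsub_cancel_of_le hmq) fun _ _ => (h'.2 _ _).trans (h''.2 _ _).symm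

lemma isIota_of_mem_closure {q : Fin k → ℕ} (hmq : m ≤ q) {S : Λ.Op m} {S' : Λ.Op q}
    (h : (S, S') ∈ (Λ.iotaGraph (add_tsub_cancel_of_le hmq)).topologicalClosure) :
    Λ.IsIota hmq S S' :=
  ⟨isAdjointable_snd_of_mem_closure _ h, iotaGraph_apply_mul _ h⟩

end KGraph

theorem proposition6p1 {k : ℕ} (Λ : KGraph k) [Λ.FinitelyAligned] :
    Λ.CompactlyAligned := by
  intro m n S T hS hT
  obtain ⟨S₀, hS₀⟩ := KGraph.exists_mem_closure_iotaGraph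
    (add_tsub_cancel_of_le (le_sup_left : m ≤ m ⊔ n)) hS
  obtain ⟨T₀, hT₀⟩ := KGraph.exists_mem_closure_iotaGraph
    (add_tsub_cancel_of_le (le_sup_right : n ≤ m ⊔ n)) hT
  have hS' := KGraph.isIota_of_mem_closure le_sup_left hS₀
  have hT' := KGraph.isIota_of_mem_closure le_sup_right hT₀
  refine ⟨⟨S₀, hS', fun S' h => h.unique _ hS'⟩, ⟨T₀, hT', fun T' h => h.unique _ hT'⟩, ?_⟩
  intro S' T' hS'' hT''
  -- By uniqueness, any operators with the defining property of ι are those found in the closed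
  -- graphs, to which the compactness result applies.
  rw [hS''.unique _ hS', hT''.unique _ hT']
  exact KGraph.comp_mem_compacts _ _ rfl hS₀ hT₀
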